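/- Let $\mathcal X$ be a set (for instance $\mathbb R^d$), $K:\mathcal X\times\mathcal X\to\mathbb R$ a positive definite kernel, $\mathcal H$ the reproducing kernel Hilbert space it induces, and $x_1,\dots,x_n\in\mathcal X$ fixed points such that the kernel matrix $K_n=(K(x_i,x_j))_{i,j=1}^n$ is not zero. Let $y_i=f_*(x_i)+\epsilon_i$, where $f_*:\mathcal X\to\mathbb R$ is a fixed function and $\epsilon_1,\dots,\epsilon_n$ are i.i.d. random variables with mean zero and finite variance $\sigma^2$, and put $Y=(y_1,\dots,y_n)$. For a function $f$ let $$\mathcal E(f)=\mathbb E\,\frac1n\sum_{i=1}^n (f(x_i)-y_i)^2,\qquad R(f)=\mathcal E(f)-\inf_{v\in\mathcal H}\mathcal E(v),$$ where $f$ is held fixed in the expectation; for an estimator $f$ computed from $Y$, $\mathbb E\,R(f)$ is the expectation of $R(f)$ over $Y$. For $\lambda>0$ let $$\tilde d(\lambda)=n\max_{1\le i\le n}\big(K_n(K_n+\lambda n I_n)^{-1}\big)_{ii},\qquad \bar f_\lambda(z)=\sum_{i=1}^n\bar\alpha_i K(z,x_i),\quad \bar\alpha=(K_n+\lambda nI_n)^{-1}Y,$$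 so that $\bar f_\lambda$ is the kernel regularized least squares (KRLS) estimator. For a set $M\subseteq\{1,\dots,n\}$ with $m$ elements, let $K_{nm}=(K(x_i,x_j))_{1\le i\le n,\,j\in M}$ and $K_{mm}=(K(x_i,x_j))_{i,j\in M}$, let $k=\operatorname{rank}K_{mm}$, and let $\mathsf R_M\in\mathbb R^{m\times k}$ be any matrix with $\mathsf R_M\mathsf R_M^\top=K_{mm}^\dagger$ (the Moore-Penrose pseudoinverse). The NYTRO estimator after $t$ iterations with step size $\gamma$ is $$\hat f_{m,\gamma,t}(z)=\sum_{j\in M}(\mathsf R_M\hat\beta_t)_jK(x_j,z),\qquad \hat\beta_0=0,\quad \hat\beta_s=\hat\beta_{s-1}-\frac{\gamma}{n}\mathsf R_M^\top K_{nm}^\top\big(K_{nm}\mathsf R_M\hat\beta_{s-1}-Y\big).$$ Let $t\ge2$ be an integer, $\gamma=1/\|K_n\|$ (operator norm), $\delta\in(0,1)$, and let $m\le n$ satisfy $$m\ \ge\ \Big(\frac{32\,\tilde d(1/(\gamma t))}{\delta}+2\Big)\log\frac{n\|K_n\|\gamma t}{\delta}.$$ If $M$ is drawn uniformly at random among the subsets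 of $\{1,\dots,n\}$ with $m$ elements, independently of the noise, then all the expectations below are finite and $$\mathbb E_M\,\mathbb E\,R\big(\hat f_{m,\gamma,t}\big)\ \le\ c_{t,\delta}\ \mathbb E\,R\big(\bar f_{1/(\gamma t)}\big),\qquad c_{t,\delta}=4\Big(1+\frac1{t-1}\Big)^2(1+4\delta)\le 80 .$$ -/

import Mathlib

open MeasureTheory ProbabilityTheory
open scoped Matrix BigOperators

namespace Nytro

noncomputable section

/-- `K` is the reproducing kernel of the reproducing kernel Hilbert space `H` of real functions on
`X`, that is, `H` is the RKHS induced by `K`. Mathlib's kernel takes values in `ℝ →L[ℝ] ℝ`, which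
is identified with `ℝ` by evaluation at `1`. In particular `K` is symmetric and positive
semidefinite. -/
def IsReproducingKernel {X : Type*} (H : Type*) [NormedAddCommGroup H] [InnerProductSpace ℝ H]
    [CompleteSpace H] [RKHS ℝ H X ℝ] (K : X → X → ℝ) : Prop :=
  ∀ u v : X, RKHS.kernel H u v 1 = K u v

/-- The empirical kernel matrix `K_n`, with entries `K (x i) (x j)`. -/
def kernelMatrix {X : Type*} {n : ℕ} (K : X → X → ℝ) (x : Fin n → X) :
    Matrix (Fin n) (Fin n) ℝ :=
  Matrix.of fun i j => K (x i) (x j)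

/-- The matrix `K_nm`: rows are all the training points, columns the points selected by `M`. -/
def crossKernelMatrix {X : Type*} {n : ℕ} (K : X → X → ℝ) (x : Fin n → X) (M : Finset (Fin n)) :
    Matrix (Fin n) M ℝ :=
  Matrix.of fun i j => K (x i) (x j)

/-- The matrix `K_mm` of the points selected by `M`. -/
def subKernelMatrix {X : Type*} {n : ℕ} (K : X → X → ℝ) (x : Fin n → X) (M : Finset (Fin n)) :
    Matrix M M ℝ :=
  Matrix.of fun i j => K (x i) (x j)

/-- The operator norm of a real square matrix for the Euclidean norm. -/
def opNorm {n : ℕ} (A : Matrix (Fin n) (Fin n) ℝ) : ℝ :=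
  ‖Matrix.toEuclideanCLM (𝕜 := ℝ) A‖

/-- `B` is the Moore–Penrose pseudoinverse of the real matrix `A`. -/
structure IsPseudoinverse {p q : Type*} [Fintype p] [Fintype q]
    (A : Matrix p q ℝ) (B : Matrix q p ℝ) : Prop where
  mul_mul_left : A * B * A = A
  mul_mul_right : B * A * B = B
  symm_left : (A * B)ᵀ = A * B
  symm_right : (B * A)ᵀ = B * A

/-- `n * max_i (K_n (K_n + lam n I)⁻¹)_{ii}`. -/
def dTilde {n : ℕ} (Kn : Matrix (Fin n) (Fin n) ℝ) (lam : ℝ) : ℝ :=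
  n * ⨆ i : Fin n, (Kn * (Kn + (lam * n) • (1 : Matrix (Fin n) (Fin n) ℝ))⁻¹) i i

/-- The kernel regularized least squares estimator
`z ↦ ∑ i, α_i K(z, x_i)` with `α = (K_n + lam n I)⁻¹ y`. -/
def krls {X : Type*} {n : ℕ} (K : X → X → ℝ) (x : Fin n → X) (lam : ℝ) (y : Fin n → ℝ) :
    X → ℝ := fun z =>
  ∑ i, ((kernelMatrix K x + (lam * n) • (1 : Matrix (Fin n) (Fin n) ℝ))⁻¹ *ᵥ y) i * K z (x i)

/-- Gradient descent in the variable `β`, started at `0`: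
`β_{t+1} = β_t - (γ / n) Rᵀ K_nmᵀ (K_nm R β_t - y)`. -/
def nytroBeta {X : Type*} {n k : ℕ} (K : X → X → ℝ) (x : Fin n → X) (M : Finset (Fin n))
    (R : Matrix M (Fin k) ℝ) (γ : ℝ) (y : Fin n → ℝ) : ℕ → (Fin k → ℝ)
  | 0 => 0
  | t + 1 =>
      nytroBeta K x M R γ y t -
        (γ / n) • (Rᵀ *ᵥ ((crossKernelMatrix K x M)ᵀ *ᵥ
          (crossKernelMatrix K x M *ᵥ (R *ᵥ nytroBeta K x M R γ y t) - y)))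

/-- The NYTRO estimator `z ↦ ∑ j ∈ M, α_j K(x_j, z)` after `t` iterations, with `α = R β_t`. -/
def nytro {X : Type*} {n k : ℕ} (K : X → X → ℝ) (x : Fin n → X) (M : Finset (Fin n))
    (R : Matrix M (Fin k) ℝ) (γ : ℝ) (t : ℕ) (y : Fin n → ℝ) : X → ℝ := fun z =>
  ∑ j : M, (R *ᵥ nytroBeta K x M R γ y t) j * K (x j) z

/-- The outputs `y_i = f_*(x_i) + ε_i`. -/
def outputs {X Ω : Type*} {n : ℕ} (x : Fin n → X) (fstar : X → ℝ) (ε : Fin n → Ω → ℝ) (ω : Ω) :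
    Fin n → ℝ := fun i => fstar (x i) + ε i ω

/-- The fixed design expected risk `𝓔(f) = 𝔼 (1/n) ∑ i, (f(x_i) - y_i)²`; here `f` is a fixed
function and the expectation is over the outputs. -/
def expectedRisk {X Ω : Type*} [MeasurableSpace Ω] {n : ℕ} (P : Measure Ω) (x : Fin n → X)
    (fstar : X → ℝ) (ε : Fin n → Ω → ℝ) (f : X → ℝ) : ℝ :=
  ∫ ω, (1 / (n : ℝ)) * ∑ i, (f (x i) - outputs x fstar ε ω i) ^ 2 ∂P

/-- The excess risk `𝓔(f) - inf_{v ∈ H} 𝓔(v)`. -/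
def excessRisk {X Ω : Type*} [MeasurableSpace Ω] {n : ℕ} (H : Type*) [NormedAddCommGroup H]
    [InnerProductSpace ℝ H] [RKHS ℝ H X ℝ] (P : Measure Ω) (x : Fin n → X)
    (fstar : X → ℝ) (ε : Fin n → Ω → ℝ) (f : X → ℝ) : ℝ :=
  expectedRisk P x fstar ε f - ⨅ v : H, expectedRisk P x fstar ε v

end

end Nytro

/-! On the design points both estimators are linear smoothers. Put `B = (γ/n) K_n`, and let `C` be
its Nyström approximation for the pivots `M`. Ridge regression acts as `H = B (B + 1/t)⁻¹`, gradient
descent as `1 - (1 - C)^t`. The target may be replaced by its best approximation in the RKHS,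
because the remainder is annihilated by `B`, `H` and `C`. The expected excess risk is then `1/n`
times squared bias plus `σ²` times the trace of the squared smoother.

The variance comparison holds for every `M`: `C ≤ B`, and `1 - (1 - l)^t ≤ 2 l / (l + 1/t)` on `[0,
1]`, which costs a factor four (`trace_gradientDescent_sq_le`). For the bias, the spectral bound `(1
- l)^t (l + 1/t) ≤ 1/t` shows that its norm grows by at most `1 + t ‖B - C‖`
(`gradientDescent_bias_le`). This is at most `2` when `B - C ≤ 1/t`, and at most `1 + t/n` always,
since `B ≤ 1/n`.

The condition `B - C ≤ 1/t` follows when a factor `S` of `H = Sᵀ S`, projected off its columns in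
`M`, leaves a Gram matrix `Z` with spectrum below `1/2` (`eigenvalue_le_of_trace_residualGram_lt`).
Failure forces `2^p tr Z^p ≥ 1`, so by Markov's inequality only `𝔼 tr Z^p` has to be small.

No matrix concentration is needed for this moment. Sampling without replacement adds one uniform new
pivot at a time; each pivot compresses `Z` by a projection of corank at most one. Berezin's
inequality and averaging over the pivot give a one-step contraction of `𝔼 tr Z^p` up to a small
additive term (`expect_trace_residualGram_pow_le`). The squared column norms of `S` are the leverage
scores `H_ii ≤ d/n`, with `d` the value of `dTilde`, so the rate depends on `d`. -/

namespace Nytro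

/-! ### Spectral calculus for real symmetric matrices, and trace inequalities -/

section Spectral

variable {ι : Type*} [Fintype ι]

/-- The vectors `u j` form an orthonormal basis of eigenvectors of the real matrix `A`, with
eigenvalues `l j`. -/
structure IsEigenbasis (A : Matrix ι ι ℝ) (u : ι → ι → ℝ) (l : ι → ℝ) : Prop where
  mulVec_eq : ∀ j, A *ᵥ u j = l j • u j
  norm_eq : ∀ j, u j ⬝ᵥ u j = 1
  parseval : ∀ x y : ι → ℝ, x ⬝ᵥ y = ∑ j, (u j ⬝ᵥ x) * (u j ⬝ᵥ y)

theorem IsEigenbasis.eigenvalue_eq {A : Matrix ι ι ℝ} {u : ι → ι → ℝ} {l : ι → ℝ}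
    (h : IsEigenbasis A u l) (j : ι) : l j = u j ⬝ᵥ (A *ᵥ u j) := by
  rw [h.mulVec_eq, dotProduct_smul, h.norm_eq, smul_eq_mul, mul_one]

theorem dotProduct_mulVec_symm {A : Matrix ι ι ℝ} (hA : Aᵀ = A) (x y : ι → ℝ) :
    x ⬝ᵥ (A *ᵥ y) = (A *ᵥ x) ⬝ᵥ y := by
  rw [Matrix.dotProduct_mulVec, ← Matrix.mulVec_transpose, hA]

variable [DecidableEq ι]

set_option linter.unusedSectionVars false

theorem exists_isEigenbasis {A : Matrix ι ι ℝ} (hA : Aᵀ = A) :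
    ∃ u l, IsEigenbasis A u l := by
  have h : A.IsHermitian := by
    rw [Matrix.IsHermitian, Matrix.conjTranspose_eq_transpose_of_trivial, hA]
  have key : ∀ (j : ι) (x : ι → ℝ), (h.eigenvectorBasis j).ofLp ⬝ᵥ x =
      inner ℝ (h.eigenvectorBasis j) (WithLp.toLp 2 x) := by
    intro j x
    simp [PiLp.inner_apply, dotProduct, mul_comm]
  refine ⟨fun j => (h.eigenvectorBasis j).ofLp, h.eigenvalues,
    fun j => h.mulVec_eigenvectorBasis j, fun j => ?_, fun x y => ?_⟩
  · rw [key]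
    simp
  · have := h.eigenvectorBasis.sum_inner_mul_inner (WithLp.toLp 2 x) (WithLp.toLp 2 y)
    simp only [key]
    have e : x ⬝ᵥ y = inner ℝ (WithLp.toLp 2 x : EuclideanSpace ℝ ι) (WithLp.toLp 2 y) := by
      simp [PiLp.inner_apply, dotProduct, mul_comm]
    rw [e, ← this]
    exact Finset.sum_congr rfl fun j _ => by rw [real_inner_comm]

theorem pow_transpose_eq {A : Matrix ι ι ℝ} (hA : Aᵀ = A) (k : ℕ) : (A ^ k)ᵀ = A ^ k := by
  rw [Matrix.transpose_pow, hA]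

namespace IsEigenbasis

variable {A : Matrix ι ι ℝ} {u : ι → ι → ℝ} {l : ι → ℝ}

theorem trace_eq (h : IsEigenbasis A u l) (X : Matrix ι ι ℝ) :
    X.trace = ∑ j, u j ⬝ᵥ (X *ᵥ u j) := by
  have h1 : ∀ i, X i i = ∑ j, u j i * (u j ᵥ* X) i := by
    intro i
    have := h.parseval (Pi.single i 1) (X *ᵥ Pi.single i 1)
    simp only [Matrix.dotProduct_mulVec, dotProduct_single_one] at this
    simpa [Matrix.vecMul, dotProduct, Pi.single_apply] using this
  simp only [Matrix.trace, Matrix.diag_apply, h1]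
  rw [Finset.sum_comm]
  refine Finset.sum_congr rfl fun j _ => ?_
  rw [Matrix.dotProduct_mulVec, dotProduct_comm]
  rfl

theorem pow_mulVec (h : IsEigenbasis A u l) (k : ℕ) (j : ι) :
    (A ^ k) *ᵥ u j = (l j) ^ k • u j := by
  induction k with
  | zero => simp
  | succ k ih =>
    rw [pow_succ, ← Matrix.mulVec_mulVec, h.mulVec_eq, Matrix.mulVec_smul, ih, smul_smul, pow_succ,
      mul_comm]

theorem trace_pow (h : IsEigenbasis A u l) (k : ℕ) : (A ^ k).trace = ∑ j, l j ^ k := by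
  rw [h.trace_eq]
  refine Finset.sum_congr rfl fun j _ => ?_
  rw [h.pow_mulVec, dotProduct_smul, h.norm_eq, smul_eq_mul, mul_one]

theorem dotProduct_mulVec_eq (h : IsEigenbasis A u l) {F : Matrix ι ι ℝ} (hF : Fᵀ = F)
    {f : ι → ℝ} (hf : ∀ j, F *ᵥ u j = f j • u j) (x : ι → ℝ) :
    x ⬝ᵥ (F *ᵥ x) = ∑ j, f j * (u j ⬝ᵥ x) ^ 2 := by
  rw [h.parseval]
  refine Finset.sum_congr rfl fun j _ => ?_
  rw [dotProduct_mulVec_symm hF, hf, smul_dotProduct, smul_eq_mul]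
  ring

/-- A function of `A` with values bounded by `c` on the spectrum has operator norm at most `c`. -/
theorem mulVec_sq_le (h : IsEigenbasis A u l) {F : Matrix ι ι ℝ} (hF : Fᵀ = F)
    {f : ι → ℝ} (hf : ∀ j, F *ᵥ u j = f j • u j) {c : ℝ} (hc : ∀ j, |f j| ≤ c) (x : ι → ℝ) :
    (F *ᵥ x) ⬝ᵥ (F *ᵥ x) ≤ c ^ 2 * (x ⬝ᵥ x) := by
  rw [h.parseval, h.parseval, Finset.mul_sum]
  refine Finset.sum_le_sum fun j _ => ?_
  rw [dotProduct_mulVec_symm hF, hf, smul_dotProduct, smul_eq_mul]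
  have : (f j) ^ 2 ≤ c ^ 2 := sq_le_sq' (abs_le.1 (hc j)).1 (abs_le.1 (hc j)).2
  nlinarith [sq_nonneg (u j ⬝ᵥ x)]

end IsEigenbasis

/-- Jensen's inequality for the spectral measure of a positive semidefinite matrix. -/
theorem pow_dotProduct_mulVec_le {Z : Matrix ι ι ℝ} (hZs : Zᵀ = Z)
    (hZ : ∀ v, 0 ≤ v ⬝ᵥ (Z *ᵥ v)) (p : ℕ) {v : ι → ℝ} (hv : v ⬝ᵥ v = 1) :
    (v ⬝ᵥ (Z *ᵥ v)) ^ p ≤ v ⬝ᵥ ((Z ^ p) *ᵥ v) := by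
  obtain ⟨u, l, h⟩ := exists_isEigenbasis hZs
  rw [h.dotProduct_mulVec_eq hZs h.mulVec_eq,
    h.dotProduct_mulVec_eq (pow_transpose_eq hZs p) (h.pow_mulVec p)]
  have := Real.pow_arith_mean_le_arith_mean_pow Finset.univ (fun j => (u j ⬝ᵥ v) ^ 2) l
    (fun j _ => sq_nonneg _) (by rw [← hv, h.parseval]; simp [sq])
    (fun j _ => by rw [h.eigenvalue_eq]; exact hZ _) p
  simpa [mul_comm] using this

theorem dotProduct_pow_mulVec_nonneg {Z : Matrix ι ι ℝ} (hZs : Zᵀ = Z)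
    (hZ : ∀ v, 0 ≤ v ⬝ᵥ (Z *ᵥ v)) (p : ℕ) (w : ι → ℝ) : 0 ≤ w ⬝ᵥ ((Z ^ p) *ᵥ w) := by
  obtain ⟨u, l, h⟩ := exists_isEigenbasis hZs
  rw [h.dotProduct_mulVec_eq (pow_transpose_eq hZs p) (h.pow_mulVec p)]
  refine Finset.sum_nonneg fun j _ => mul_nonneg (pow_nonneg ?_ _) (sq_nonneg _)
  rw [h.eigenvalue_eq]
  exact hZ _

/-- Berezin's trace inequality for an orthogonal projection. -/
theorem trace_compression_pow_le {Z Q : Matrix ι ι ℝ} (hZs : Zᵀ = Z)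
    (hZ : ∀ v, 0 ≤ v ⬝ᵥ (Z *ᵥ v)) (hQs : Qᵀ = Q) (hQ : Q * Q = Q) {p : ℕ} (hp : p ≠ 0) :
    ((Q * Z * Q) ^ p).trace ≤ (Q * Z ^ p).trace := by
  have hs : (Q * Z * Q)ᵀ = Q * Z * Q := by
    simp [Matrix.transpose_mul, hQs, hZs, Matrix.mul_assoc]
  obtain ⟨u, l, h⟩ := exists_isEigenbasis hs
  have hcyc : (Q * Z ^ p).trace = (Q * Z ^ p * Q).trace := by
    rw [Matrix.trace_mul_comm (Q * Z ^ p) Q, ← Matrix.mul_assoc, hQ]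
  have hquad : ∀ (X : Matrix ι ι ℝ) (w : ι → ℝ),
      w ⬝ᵥ ((Q * X * Q) *ᵥ w) = (Q *ᵥ w) ⬝ᵥ (X *ᵥ (Q *ᵥ w)) := by
    intro X w
    rw [← Matrix.mulVec_mulVec, ← Matrix.mulVec_mulVec, dotProduct_mulVec_symm hQs]
  rw [hcyc, h.trace_pow, h.trace_eq]
  refine Finset.sum_le_sum fun j _ => ?_
  rw [hquad]
  -- An eigenvector with nonzero eigenvalue lies in the range of `Q`, so it is a unit vector to
  -- which Jensen applies. A zero eigenvalue contributes `0 ^ p = 0`, which is where `p ≠ 0`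
  -- matters.
  by_cases hj : l j = 0
  · rw [hj, zero_pow hp]
    exact dotProduct_pow_mulVec_nonneg hZs hZ p _
  · have hfix : Q *ᵥ u j = u j := by
      have e : u j = (l j)⁻¹ • ((Q * Z * Q) *ᵥ u j) := by
        rw [h.mulVec_eq, smul_smul, inv_mul_cancel₀ hj, one_smul]
      rw [e, Matrix.mulVec_smul, Matrix.mulVec_mulVec, ← Matrix.mul_assoc, ← Matrix.mul_assoc, hQ]
    rw [hfix]
    refine le_trans (le_of_eq ?_) (pow_dotProduct_mulVec_le hZs hZ p (h.norm_eq j))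
    rw [h.eigenvalue_eq, hquad, hfix]

/-- For an eigenvector `v` of `D` with eigenvalue `l`, the infimal convolution of the quadratic
forms of `D` and of `a` is at least `a l / (l + a)` at `v`. -/
theorem eigen_infConv_le {D : Matrix ι ι ℝ} (hDs : Dᵀ = D) (hD : ∀ v, 0 ≤ v ⬝ᵥ (D *ᵥ v))
    {a : ℝ} (ha : 0 < a) {v : ι → ℝ} {l : ℝ} (hv : D *ᵥ v = l • v) (hv1 : v ⬝ᵥ v = 1)
    (z : ι → ℝ) :
    a * l / (l + a) ≤ (v - z) ⬝ᵥ (D *ᵥ (v - z)) + a * (z ⬝ᵥ z) := by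
  have hl : 0 ≤ l := by
    have := hD v
    rwa [hv, dotProduct_smul, hv1, smul_eq_mul, mul_one] at this
  set s := v ⬝ᵥ z with hs
  have h1 := hD (z - s • v)
  have h2 : 0 ≤ (z - s • v) ⬝ᵥ (z - s • v) := by
    simpa using dotProduct_star_self_nonneg (z - s • v)
  have hvz : v ⬝ᵥ (D *ᵥ z) = l * s := by
    rw [dotProduct_mulVec_symm hDs, hv, smul_dotProduct, smul_eq_mul]
  have hzv : z ⬝ᵥ v = s := dotProduct_comm _ _
  simp only [Matrix.mulVec_sub, Matrix.mulVec_smul, sub_dotProduct, dotProduct_sub,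
    smul_dotProduct, dotProduct_smul, smul_eq_mul, hv, hvz, hzv, hv1, ← hs] at h1 h2 ⊢
  rw [div_le_iff₀ (by positivity)]
  have hla : 0 < l + a := by positivity
  -- Both quadratic forms decrease when `z` is replaced by its component `s • v`. What remains is
  -- the scalar minimum of `l (1 - s)² + a s²`, attained at `s = l / (l + a)`.
  have h3 : l * s ^ 2 ≤ z ⬝ᵥ (D *ᵥ z) := by linarith
  have h4 : a * s ^ 2 ≤ a * (z ⬝ᵥ z) := mul_le_mul_of_nonneg_left (by linarith) ha.le
  have h5 : a * l ≤ (l * (1 - s) ^ 2 + a * s ^ 2) * (l + a) := by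
    nlinarith [sq_nonneg ((l + a) * s - l)]
  refine h5.trans (mul_le_mul_of_nonneg_right ?_ hla.le)
  linarith

end Spectral

/-! ### Residuals after projecting out selected columns -/

section Pivoting

variable {ι : Type*} [Fintype ι] [DecidableEq ι]

set_option linter.unusedSectionVars false

/-- `Q` is the orthogonal projection onto the orthogonal complement of the span of the columns of
`S` with indices in `M`. -/
structure IsResidualProj (S : Matrix ι ι ℝ) (M : Finset ι) (Q : Matrix ι ι ℝ) : Prop where
  symm : Qᵀ = Q
  mulVec_col : ∀ i ∈ M, Q *ᵥ S.col i = 0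
  exists_coeff : ∀ y : ι → ℝ, ∃ w : ι → ℝ, (∀ i, i ∉ M → w i = 0) ∧ y - Q *ᵥ y = S *ᵥ w

namespace IsResidualProj

variable {S : Matrix ι ι ℝ} {M N : Finset ι} {Q P : Matrix ι ι ℝ}

theorem mulVec_mulVec_eq_zero (h : IsResidualProj S M Q) {w : ι → ℝ}
    (hw : ∀ i, i ∉ M → w i = 0) : Q *ᵥ (S *ᵥ w) = 0 := by
  have e : S *ᵥ w = ∑ i, w i • S.col i := by
    rw [Matrix.mulVec_eq_sum]
    simp [Matrix.col]
  rw [e, Matrix.mulVec_sum]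
  refine Finset.sum_eq_zero fun i _ => ?_
  rw [Matrix.mulVec_smul]
  by_cases hi : i ∈ M
  · rw [h.mulVec_col i hi, smul_zero]
  · rw [hw i hi, zero_smul]

/-- `y - Q y` is a combination of columns in `M`, hence in `N`, and `P` kills it. Idempotence and
uniqueness are the cases `M = N`. -/
theorem mul_eq (hQ : IsResidualProj S M Q) (hP : IsResidualProj S N P) (hMN : M ⊆ N) :
    P * Q = P := by
  refine Matrix.ext_of_mulVec_single fun i => ?_
  obtain ⟨w, hw, e⟩ := hQ.exists_coeff (Pi.single i 1)
  have h0 := hP.mulVec_mulVec_eq_zero (w := w) fun i hi => hw i fun h => hi (hMN h)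
  rw [← e, Matrix.mulVec_sub, sub_eq_zero] at h0
  rw [← Matrix.mulVec_mulVec, h0]

theorem mul_self (h : IsResidualProj S M Q) : Q * Q = Q :=
  h.mul_eq h subset_rfl

theorem unique (hQ : IsResidualProj S M Q) (hP : IsResidualProj S M P) : P = Q := by
  have h1 := congrArg Matrix.transpose (hQ.mul_eq hP subset_rfl)
  rw [Matrix.transpose_mul, hQ.symm, hP.symm, hP.mul_eq hQ subset_rfl] at h1
  exact h1.symm

theorem empty (S : Matrix ι ι ℝ) : IsResidualProj S ∅ 1 where
  symm := Matrix.transpose_one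
  mulVec_col := by simp
  exists_coeff y := ⟨0, by simp, by simp⟩

/-- One step of the Gram-Schmidt process. -/
theorem insert (h : IsResidualProj S M Q) (i : ι) :
    IsResidualProj S (insert i M) (Q - (Q *ᵥ S.col i ⬝ᵥ Q *ᵥ S.col i)⁻¹ •
      Matrix.vecMulVec (Q *ᵥ S.col i) (Q *ᵥ S.col i)) where
  symm := by
    rw [Matrix.transpose_sub, Matrix.transpose_smul, Matrix.transpose_vecMulVec, h.symm]
  mulVec_col j hj := by
    set q := Q *ᵥ S.col i with hq
    have key : ∀ y, q ⬝ᵥ y = q ⬝ᵥ Q *ᵥ y := by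
      intro y
      rw [dotProduct_mulVec_symm h.symm, hq, Matrix.mulVec_mulVec, h.mul_self]
    rw [Matrix.sub_mulVec, Matrix.smul_mulVec, Matrix.vecMulVec_mulVec, key (S.col j)]
    rcases Finset.mem_insert.1 hj with rfl | hj
    · rw [← hq]
      -- If the new column already lies in the span, `0⁻¹ = 0` makes the correction vanish, so
      -- linear dependence needs no separate treatment.
      by_cases h0 : q = 0
      · simp [h0]
      · have : q ⬝ᵥ q ≠ 0 := fun e => h0 (dotProduct_self_eq_zero.1 e)
        ext k
        simp [this]
    · rw [h.mulVec_col j hj]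
      simp
  exists_coeff y := by
    set q := Q *ᵥ S.col i with hq
    obtain ⟨w, hw, e⟩ := h.exists_coeff y
    obtain ⟨w', hw', e'⟩ := h.exists_coeff (S.col i)
    set c := (q ⬝ᵥ q)⁻¹ * (q ⬝ᵥ y) with hc
    refine ⟨w + c • (Pi.single i 1 - w'), fun k hk => ?_, ?_⟩
    · rw [Finset.mem_insert, not_or] at hk
      simp [hw k hk.2, hw' k hk.2, hk.1]
    · have h1 : S *ᵥ Pi.single i 1 - S *ᵥ w' = q := by
        rw [← e', Matrix.mulVec_single_one, hq, sub_sub_cancel]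
      rw [Matrix.mulVec_add, Matrix.mulVec_smul, Matrix.mulVec_sub, h1, ← e, Matrix.sub_mulVec,
        Matrix.smul_mulVec, Matrix.vecMulVec_mulVec, hc]
      ext k
      simp
      ring

end IsResidualProj

theorem exists_isResidualProj (S : Matrix ι ι ℝ) (M : Finset ι) :
    ∃ Q, IsResidualProj S M Q := by
  induction M using Finset.induction_on with
  | empty => exact ⟨1, .empty S⟩
  | insert i M _ ih =>
    obtain ⟨Q, hQ⟩ := ih
    exact ⟨_, hQ.insert i⟩

/-- The orthogonal projection onto the complement of the columns of `S` selected by `M`. -/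
noncomputable def residualProj (S : Matrix ι ι ℝ) (M : Finset ι) : Matrix ι ι ℝ :=
  (exists_isResidualProj S M).choose

theorem isResidualProj_residualProj (S : Matrix ι ι ℝ) (M : Finset ι) :
    IsResidualProj S M (residualProj S M) :=
  (exists_isResidualProj S M).choose_spec

/-- The compression of `S Sᵀ` to the complement of the columns of `S` selected by `M`. -/
noncomputable def residualGram (S : Matrix ι ι ℝ) (M : Finset ι) : Matrix ι ι ℝ :=
  residualProj S M * (S * Sᵀ) * residualProj S M

theorem residualGram_transpose (S : Matrix ι ι ℝ) (M : Finset ι) :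
    (residualGram S M)ᵀ = residualGram S M := by
  simp [residualGram, Matrix.transpose_mul, (isResidualProj_residualProj S M).symm,
    Matrix.mul_assoc]

theorem dotProduct_residualGram_mulVec (S : Matrix ι ι ℝ) (M : Finset ι) (v : ι → ℝ) :
    v ⬝ᵥ (residualGram S M *ᵥ v) =
      (Sᵀ *ᵥ (residualProj S M *ᵥ v)) ⬝ᵥ (Sᵀ *ᵥ (residualProj S M *ᵥ v)) := by
  rw [residualGram, ← Matrix.mulVec_mulVec, ← Matrix.mulVec_mulVec, ← Matrix.mulVec_mulVec,
    dotProduct_mulVec_symm (isResidualProj_residualProj S M).symm, Matrix.dotProduct_mulVec,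
    ← Matrix.mulVec_transpose]

theorem dotProduct_residualGram_nonneg (S : Matrix ι ι ℝ) (M : Finset ι) (v : ι → ℝ) :
    0 ≤ v ⬝ᵥ (residualGram S M *ᵥ v) := by
  rw [dotProduct_residualGram_mulVec]
  simpa using dotProduct_star_self_nonneg (Sᵀ *ᵥ (residualProj S M *ᵥ v))

theorem trace_vecMulVec_mul (q : ι → ℝ) (X : Matrix ι ι ℝ) :
    (Matrix.vecMulVec q q * X).trace = q ⬝ᵥ (X *ᵥ q) := by
  rw [Matrix.vecMulVec_mul, Matrix.trace_vecMulVec, Matrix.dotProduct_mulVec, dotProduct_comm]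

theorem residualProj_col_sq_le (S : Matrix ι ι ℝ) (M : Finset ι) (i : ι) :
    (residualProj S M *ᵥ S.col i) ⬝ᵥ (residualProj S M *ᵥ S.col i) ≤ S.col i ⬝ᵥ S.col i := by
  have h := isResidualProj_residualProj S M
  set Q := residualProj S M
  set s := S.col i
  have h1 : 0 ≤ (s - Q *ᵥ s) ⬝ᵥ (s - Q *ᵥ s) := by
    simpa using dotProduct_star_self_nonneg (s - Q *ᵥ s)
  have h2 : (Q *ᵥ s) ⬝ᵥ (Q *ᵥ s) = s ⬝ᵥ (Q *ᵥ s) := by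
    rw [dotProduct_mulVec_symm h.symm, Matrix.mulVec_mulVec, h.mul_self, dotProduct_comm]
  rw [sub_dotProduct, dotProduct_sub, dotProduct_sub, h2, dotProduct_comm (Q *ᵥ s) s] at h1
  linarith

/-- Adding the index `i` to the pivots decreases the trace of the power of the residual. -/
theorem trace_residualGram_insert_pow_le (S : Matrix ι ι ℝ) (M : Finset ι) (i : ι) {b : ℝ}
    (hS : S.col i ⬝ᵥ S.col i ≤ b) {p : ℕ} (hp : p ≠ 0) :
    (residualGram S (insert i M) ^ p).trace ≤ (residualGram S M ^ p).trace -
      b⁻¹ * ((residualProj S M *ᵥ S.col i) ⬝ᵥ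
        (residualGram S M ^ p *ᵥ (residualProj S M *ᵥ S.col i))) := by
  have hQ := isResidualProj_residualProj S M
  have hP := isResidualProj_residualProj S (insert i M)
  have hle := residualProj_col_sq_le S M i
  have hPQ := hQ.mul_eq hP (Finset.subset_insert i M)
  have hQP : residualProj S M * residualProj S (insert i M) = residualProj S (insert i M) := by
    have := congrArg Matrix.transpose hPQ
    rwa [Matrix.transpose_mul, hQ.symm, hP.symm] at this
  have hP' := (hQ.insert i).unique hP
  have e : residualGram S (insert i M) =
      residualProj S (insert i M) * residualGram S M * residualProj S (insert i M) := by
    have : ∀ A B T : Matrix ι ι ℝ, A * (B * T * B) * A = (A * B) * T * (B * A) := by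
      intro A B T
      simp only [Matrix.mul_assoc]
    rw [residualGram, residualGram, this, hPQ, hQP]
  rw [e]
  refine (trace_compression_pow_le (residualGram_transpose S M)
    (dotProduct_residualGram_nonneg S M) hP.symm hP.mul_self hp).trans ?_
  -- Every positive power of the residual starts with a factor `Q`; the zeroth power would not.
  have hQZ : residualProj S M * residualGram S M ^ p = residualGram S M ^ p := by
    obtain ⟨k, rfl⟩ := Nat.exists_eq_succ_of_ne_zero hp
    rw [Nat.succ_eq_add_one, pow_succ', ← Matrix.mul_assoc]
    congr 1
    rw [residualGram, ← Matrix.mul_assoc, ← Matrix.mul_assoc, hQ.mul_self]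
  rw [hP', Matrix.sub_mul, Matrix.trace_sub, hQZ, Matrix.smul_mul, Matrix.trace_smul,
    trace_vecMulVec_mul, smul_eq_mul]
  set q := residualProj S M *ᵥ S.col i
  have h0 := dotProduct_pow_mulVec_nonneg (residualGram_transpose S M)
    (dotProduct_residualGram_nonneg S M) p q
  by_cases hq : q = 0
  · simp [hq]
  · have hqq : 0 < q ⬝ᵥ q := by
      refine lt_of_le_of_ne ?_ fun e => hq (dotProduct_self_eq_zero.1 e.symm)
      simpa using dotProduct_star_self_nonneg q
    have := inv_anti₀ hqq (hle.trans hS)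
    nlinarith

/-- The residual is `(Q S)(Q S)ᵀ`, so summing its quadratic form over the columns of `Q S` raises
the power inside the trace by one. -/
theorem sum_dotProduct_residualGram_pow (S : Matrix ι ι ℝ) (M : Finset ι) (p : ℕ) :
    ∑ i, (residualProj S M *ᵥ S.col i) ⬝ᵥ
        (residualGram S M ^ p *ᵥ (residualProj S M *ᵥ S.col i)) =
      (residualGram S M ^ (p + 1)).trace := by
  have hQ := isResidualProj_residualProj S M
  set Q := residualProj S M
  have e : (residualGram S M ^ (p + 1)).trace =
      ((Q * S)ᵀ * (residualGram S M ^ p * (Q * S))).trace := by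
    rw [pow_succ, Matrix.trace_mul_comm (Q * S)ᵀ, Matrix.mul_assoc, Matrix.transpose_mul, hQ.symm,
      residualGram]
    simp only [Matrix.mul_assoc]
    rfl
  rw [e]
  refine Finset.sum_congr rfl fun i _ => ?_
  rfl

/-- The one-step gain, summed over all possible new pivots. Indices already in `M` have zero
residual column, so the sum over the complement captures the full trace. -/
theorem sum_trace_residualGram_insert_pow_le (S : Matrix ι ι ℝ) (M : Finset ι) {b : ℝ}
    (hS : ∀ i, S.col i ⬝ᵥ S.col i ≤ b) {p : ℕ} (hp : p ≠ 0) :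
    ∑ i ∈ Mᶜ, (residualGram S (insert i M) ^ p).trace ≤
      (Mᶜ.card : ℝ) * (residualGram S M ^ p).trace -
        b⁻¹ * (residualGram S M ^ (p + 1)).trace := by
  have h := Finset.sum_le_sum fun i (_ : i ∈ Mᶜ) =>
    trace_residualGram_insert_pow_le S M i (hS i) hp
  refine h.trans (le_of_eq ?_)
  rw [Finset.sum_sub_distrib, Finset.sum_const, nsmul_eq_mul, ← Finset.mul_sum,
    ← sum_dotProduct_residualGram_pow]
  congr 2
  refine Finset.sum_subset (Finset.subset_univ _) fun i _ hi => ?_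
  rw [(isResidualProj_residualProj S M).mulVec_col i (by simpa using hi), zero_dotProduct]

end Pivoting

/-! ### Uniform sampling of pivots and decay of trace moments -/

section Sampling

variable {ι : Type*} [Fintype ι] [DecidableEq ι]

set_option linter.unusedSectionVars false

/-- Double counting of the pairs of an `(s + 1)`-set and one of its elements. -/
theorem sum_powersetCard_succ (s : ℕ) (f : Finset ι → ℝ) :
    ((s : ℝ) + 1) * ∑ N ∈ Finset.powersetCard (s + 1) Finset.univ, f N =
      ∑ M ∈ Finset.powersetCard s Finset.univ, ∑ i ∈ Mᶜ, f (insert i M) := by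
  have h1 : ((s : ℝ) + 1) * ∑ N ∈ Finset.powersetCard (s + 1) Finset.univ, f N =
      ∑ N ∈ Finset.powersetCard (s + 1) (Finset.univ : Finset ι), ∑ _i ∈ N, f N := by
    rw [Finset.mul_sum]
    refine Finset.sum_congr rfl fun N hN => ?_
    rw [Finset.sum_const, (Finset.mem_powersetCard.1 hN).2, nsmul_eq_mul]
    push_cast
    rfl
  rw [h1, Finset.sum_sigma', Finset.sum_sigma']
  refine Finset.sum_bij' (fun x _ => ⟨x.1.erase x.2, x.2⟩) (fun x _ => ⟨insert x.2 x.1, x.2⟩)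
    ?_ ?_ ?_ ?_ ?_
  · rintro ⟨N, i⟩ h
    simp only [Finset.mem_sigma, Finset.mem_powersetCard, Finset.subset_univ, true_and,
      Finset.mem_compl] at h ⊢
    exact ⟨by rw [Finset.card_erase_of_mem h.2, h.1]; rfl, Finset.notMem_erase _ _⟩
  · rintro ⟨M, i⟩ h
    simp only [Finset.mem_sigma, Finset.mem_powersetCard, Finset.subset_univ, true_and,
      Finset.mem_compl] at h ⊢
    exact ⟨by rw [Finset.card_insert_of_notMem h.2, h.1], Finset.mem_insert_self _ _⟩
  · rintro ⟨N, i⟩ h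
    simp only [Finset.mem_sigma] at h
    simp [Finset.insert_erase h.2]
  · rintro ⟨M, i⟩ h
    simp only [Finset.mem_sigma, Finset.mem_compl] at h
    simp [Finset.erase_insert h.2]
  · rintro ⟨N, i⟩ h
    simp only [Finset.mem_sigma] at h
    simp [Finset.insert_erase h.2]

theorem expect_powersetCard_succ {s : ℕ} (hs : s < Fintype.card ι) (f : Finset ι → ℝ) :
    Finset.expect (Finset.powersetCard (s + 1) Finset.univ) f =
      Finset.expect (Finset.powersetCard s Finset.univ)
        fun M => (∑ i ∈ Mᶜ, f (insert i M)) / ((Fintype.card ι : ℝ) - s) := by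
  have h := sum_powersetCard_succ s f
  have hn : (0 : ℝ) < (Fintype.card ι : ℝ) - s := sub_pos.2 (by exact_mod_cast hs)
  have hc : ((Fintype.card ι).choose (s + 1) : ℝ) * (s + 1) =
      (Fintype.card ι).choose s * ((Fintype.card ι : ℝ) - s) := by
    rw [← Nat.cast_sub hs.le]
    exact_mod_cast Nat.choose_succ_right_eq (Fintype.card ι) s
  have h0 : (0 : ℝ) < (Fintype.card ι).choose s := by
    exact_mod_cast Nat.choose_pos hs.le
  have h0' : (0 : ℝ) < (Fintype.card ι).choose (s + 1) := by
    exact_mod_cast Nat.choose_pos hs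
  rw [Finset.expect_eq_sum_div_card, Finset.expect_eq_sum_div_card, ← Finset.sum_div, ← h,
    Finset.card_powersetCard, Finset.card_powersetCard, Finset.card_univ, div_div,
    mul_comm ((Fintype.card ι : ℝ) - s), ← hc]
  have : (0 : ℝ) < (s : ℝ) + 1 := by positivity
  field_simp

/-- Eigenvalue by eigenvalue, `(l - c)(l ^ p - c ^ p) ≥ 0` gives more than is needed. This closes
the recursion, which otherwise couples the moment `p` to the moment `p + 1`. -/
theorem trace_pow_succ_ge {Z : Matrix ι ι ℝ} (hZs : Zᵀ = Z) (hZ : ∀ v, 0 ≤ v ⬝ᵥ (Z *ᵥ v))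
    (p : ℕ) {c : ℝ} (hc : 0 ≤ c) :
    c * (Z ^ p).trace - Fintype.card ι * c ^ (p + 1) ≤ (Z ^ (p + 1)).trace := by
  obtain ⟨u, l, h⟩ := exists_isEigenbasis hZs
  rw [h.trace_pow, h.trace_pow, Finset.mul_sum, sub_le_iff_le_add]
  have : (Fintype.card ι : ℝ) * c ^ (p + 1) = ∑ _j : ι, c ^ (p + 1) := by simp
  rw [this, ← Finset.sum_add_distrib]
  refine Finset.sum_le_sum fun j _ => ?_
  have hl : 0 ≤ l j := by
    rw [h.eigenvalue_eq]
    exact hZ _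
  rw [pow_succ, pow_succ]
  have h1 := pow_nonneg hl p
  have h2 := pow_nonneg hc p
  rcases le_total c (l j) with hcl | hcl
  · nlinarith [mul_nonneg h2 hc, mul_le_mul_of_nonneg_left hcl h1]
  · have := pow_le_pow_left₀ hl hcl p
    nlinarith [mul_nonneg h1 hl, mul_le_mul_of_nonneg_left this hc]

theorem trace_residualGram_pow_nonneg (S : Matrix ι ι ℝ) (M : Finset ι) (p : ℕ) :
    0 ≤ (residualGram S M ^ p).trace := by
  obtain ⟨u, l, h⟩ := exists_isEigenbasis (residualGram_transpose S M)
  rw [h.trace_pow]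
  refine Finset.sum_nonneg fun j _ => pow_nonneg ?_ _
  rw [h.eigenvalue_eq]
  exact dotProduct_residualGram_nonneg S M _

theorem trace_residualGram_empty_pow_le {S : Matrix ι ι ℝ}
    (hS : ∀ v, (S *ᵥ v) ⬝ᵥ (S *ᵥ v) ≤ v ⬝ᵥ v) (p : ℕ) :
    (residualGram S ∅ ^ p).trace ≤ Fintype.card ι := by
  have e : residualGram S ∅ = S * Sᵀ := by
    rw [residualGram, (IsResidualProj.empty S).unique (isResidualProj_residualProj S ∅)]
    simp
  obtain ⟨u, l, h⟩ := exists_isEigenbasis (residualGram_transpose S ∅)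
  have hl : ∀ j, 0 ≤ l j := fun j => by
    rw [h.eigenvalue_eq]
    exact dotProduct_residualGram_nonneg S _ _
  have : (Fintype.card ι : ℝ) = ∑ _j : ι, 1 := by simp
  rw [h.trace_pow, this]
  refine Finset.sum_le_sum fun j _ => pow_le_one₀ (hl j) ?_
  have h1 := hS (Sᵀ *ᵥ u j)
  rw [Matrix.mulVec_mulVec, ← e, h.mulVec_eq] at h1
  have h2 : (Sᵀ *ᵥ u j) ⬝ᵥ (Sᵀ *ᵥ u j) = l j := by
    rw [h.eigenvalue_eq, e, ← Matrix.mulVec_mulVec, Matrix.dotProduct_mulVec (u j),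
      ← Matrix.mulVec_transpose]
  rw [h2, smul_dotProduct, dotProduct_smul, h.norm_eq] at h1
  simp only [smul_eq_mul, mul_one] at h1
  by_contra hlt
  nlinarith [hl j]

/-- The moments of the residual after uniform sampling of `m` pivots decay geometrically. -/
theorem expect_trace_residualGram_pow_le [Nonempty ι] {S : Matrix ι ι ℝ}
    (hS : ∀ v, (S *ᵥ v) ⬝ᵥ (S *ᵥ v) ≤ v ⬝ᵥ v) {c d : ℝ} (hc : 0 < c) (hcd : c ≤ d)
    (hd : ∀ i, S.col i ⬝ᵥ S.col i ≤ d / Fintype.card ι) {p : ℕ} (hp : p ≠ 0) (m : ℕ)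
    (hm : m ≤ Fintype.card ι) :
    Finset.expect (Finset.powersetCard m Finset.univ) (fun M => (residualGram S M ^ p).trace) ≤
      Fintype.card ι * (c ^ p + (1 - c / d) ^ m) := by
  have hd0 : 0 < d := hc.trans_le hcd
  have hn : (0 : ℝ) < Fintype.card ι := by exact_mod_cast Fintype.card_pos
  have hcd1 : 0 ≤ 1 - c / d := sub_nonneg.2 ((div_le_one hd0).2 hcd)
  induction m with
  | zero =>
    simp only [Finset.powersetCard_zero, Finset.expect_singleton, pow_zero]
    have := trace_residualGram_empty_pow_le hS p
    nlinarith [pow_pos hc p]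
  | succ s ih =>
    have hs : s < Fintype.card ι := hm
    have hns : (0 : ℝ) < (Fintype.card ι : ℝ) - s := sub_pos.2 (by exact_mod_cast hs)
    have hle : ∀ M ∈ Finset.powersetCard s (Finset.univ : Finset ι),
        (∑ i ∈ Mᶜ, (residualGram S (insert i M) ^ p).trace) / ((Fintype.card ι : ℝ) - s) ≤
          (1 - c / d) * (residualGram S M ^ p).trace + Fintype.card ι * c ^ (p + 1) / d := by
      intro M hM
      have h1 := sum_trace_residualGram_insert_pow_le S M hd hp
      have hcard : (Mᶜ.card : ℝ) = (Fintype.card ι : ℝ) - s := by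
        rw [Finset.card_compl, (Finset.mem_powersetCard.1 hM).2, Nat.cast_sub hs.le]
      have h2 := trace_pow_succ_ge (residualGram_transpose S M)
        (dotProduct_residualGram_nonneg S M) p hc.le
      have h3 := trace_residualGram_pow_nonneg S M (p + 1)
      rw [hcard, inv_div] at h1
      rw [div_le_iff₀ hns]
      set A := (residualGram S M ^ p).trace
      set B := (residualGram S M ^ (p + 1)).trace
      -- Only `n - s ≤ n` is used: not repeating pivots can only help.
      have h4 : ((Fintype.card ι : ℝ) - s) * (B / d) ≤ Fintype.card ι / d * B := by
        rw [div_mul_eq_mul_div, mul_div_assoc]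
        refine mul_le_mul_of_nonneg_right ?_ (div_nonneg h3 hd0.le)
        linarith [Nat.cast_nonneg (α := ℝ) s]
      have h5 : (c * A - Fintype.card ι * c ^ (p + 1)) / d ≤ B / d :=
        div_le_div_of_nonneg_right h2 hd0.le
      have h6 := mul_le_mul_of_nonneg_left h5 hns.le
      have h7 : ((1 - c / d) * A + Fintype.card ι * c ^ (p + 1) / d) =
          A - (c * A - Fintype.card ι * c ^ (p + 1)) / d := by ring
      rw [h7]
      linarith
    rw [expect_powersetCard_succ hs]
    refine (Finset.expect_le_expect hle).trans ?_
    have hne : (Finset.powersetCard s (Finset.univ : Finset ι)).Nonempty := by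
      rw [Finset.powersetCard_nonempty]
      exact hs.le
    rw [Finset.expect_add_distrib, Finset.expect_const hne, ← Finset.mul_expect]
    have h8 := mul_le_mul_of_nonneg_left (ih hs.le) hcd1
    -- `n c ^ p` is the fixed point of `x ↦ (1 - c/d) x + n c ^ (p+1) / d`, so the induction
    -- hypothesis reproduces itself exactly.
    refine (add_le_add_left h8 _).trans (le_of_eq ?_)
    rw [pow_succ, pow_succ]
    field_simp
    ring

/-- When `d < c` all eigenvalues of the residual are below `c`. -/
theorem trace_residualGram_pow_le [Nonempty ι] {S : Matrix ι ι ℝ} {c d : ℝ} (hcd : d ≤ c)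
    (hd : ∀ i, S.col i ⬝ᵥ S.col i ≤ d / Fintype.card ι) (p : ℕ) (M : Finset ι) :
    (residualGram S M ^ p).trace ≤ Fintype.card ι * c ^ p := by
  obtain ⟨u, l, h⟩ := exists_isEigenbasis (residualGram_transpose S M)
  have hl : ∀ j, 0 ≤ l j := fun j => by
    rw [h.eigenvalue_eq]
    exact dotProduct_residualGram_nonneg S _ _
  have hn : (0 : ℝ) < Fintype.card ι := by exact_mod_cast Fintype.card_pos
  have htr : ∑ j, l j ≤ d := by
    have h1 := sum_dotProduct_residualGram_pow S M 0
    have h2 := h.trace_pow 1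
    simp only [pow_one] at h2
    simp only [pow_zero, Matrix.one_mulVec, zero_add, pow_one] at h1
    rw [← h2, ← h1]
    refine (Finset.sum_le_sum fun i _ => (residualProj_col_sq_le S M i).trans (hd i)).trans ?_
    rw [Finset.sum_const, nsmul_eq_mul, Finset.card_univ, mul_div_cancel₀ _ hn.ne']
  have : (Fintype.card ι : ℝ) * c ^ p = ∑ _j : ι, c ^ p := by simp
  rw [h.trace_pow, this]
  refine Finset.sum_le_sum fun j _ => pow_le_pow_left₀ (hl j) ?_ p
  exact ((Finset.single_le_sum (fun i _ => hl i) (Finset.mem_univ j)).trans htr).trans hcd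

/-- For `c ≤ d` the geometric factor is at most `exp (-c m / d)`. For `d ≤ c` no sampling is needed,
since the trace of the residual, at most `d`, already bounds every eigenvalue by `c`. -/
theorem expect_trace_residualGram_pow_le_exp [Nonempty ι] {S : Matrix ι ι ℝ}
    (hS : ∀ v, (S *ᵥ v) ⬝ᵥ (S *ᵥ v) ≤ v ⬝ᵥ v) {c d r : ℝ} (hc : 0 < c)
    (hd : ∀ i, S.col i ⬝ᵥ S.col i ≤ d / Fintype.card ι) {p : ℕ} (hp : p ≠ 0) {m : ℕ}
    (hm : m ≤ Fintype.card ι) (hr : r * d ≤ m) :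
    Finset.expect (Finset.powersetCard m Finset.univ) (fun M => (residualGram S M ^ p).trace) ≤
      Fintype.card ι * (c ^ p + Real.exp (-(c * r))) := by
  have hn : (0 : ℝ) < Fintype.card ι := by exact_mod_cast Fintype.card_pos
  rcases le_total c d with hcd | hcd
  · have hd0 : 0 < d := hc.trans_le hcd
    refine (expect_trace_residualGram_pow_le hS hc hcd hd hp m hm).trans ?_
    refine mul_le_mul_of_nonneg_left (add_le_add_right ?_ _) hn.le
    have h1 : 1 - c / d ≤ Real.exp (-(c / d)) := by
      linarith [Real.add_one_le_exp (-(c / d))]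
    refine (pow_le_pow_left₀ (sub_nonneg.2 ((div_le_one hd0).2 hcd)) h1 m).trans ?_
    rw [← Real.exp_nat_mul, Real.exp_le_exp]
    have : c * r ≤ m * (c / d) := by
      rw [← mul_div_assoc, le_div_iff₀ hd0]
      nlinarith
    linarith
  · refine Finset.expect_le (by rwa [Finset.powersetCard_nonempty]) fun M _ => ?_
    refine (trace_residualGram_pow_le hcd hd p M).trans ?_
    nlinarith [Real.exp_pos (-(c * r))]

end Sampling

/-! ### Deterministic comparison of gradient descent with ridge regression -/

section BiasVariance

variable {ι : Type*} [Fintype ι]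

theorem dotProduct_self_nonneg' (v : ι → ℝ) : 0 ≤ v ⬝ᵥ v := by
  simpa using dotProduct_star_self_nonneg v

theorem dotProduct_sq_le (x y : ι → ℝ) : (x ⬝ᵥ y) ^ 2 ≤ (x ⬝ᵥ x) * (y ⬝ᵥ y) := by
  have := Finset.sum_mul_sq_le_sq_mul_sq Finset.univ x y
  simpa [dotProduct, sq] using this

theorem add_dotProduct_add_le {p q : ι → ℝ} {a b X : ℝ} (ha : 0 ≤ a) (hb : 0 ≤ b) (hX : 0 ≤ X)
    (hp : p ⬝ᵥ p ≤ a ^ 2 * X) (hq : q ⬝ᵥ q ≤ b ^ 2 * X) :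
    (p + q) ⬝ᵥ (p + q) ≤ (a + b) ^ 2 * X := by
  have h : (p ⬝ᵥ q) ^ 2 ≤ (a * b * X) ^ 2 := by
    refine (dotProduct_sq_le p q).trans ?_
    calc (p ⬝ᵥ p) * (q ⬝ᵥ q) ≤ (a ^ 2 * X) * (b ^ 2 * X) :=
          mul_le_mul hp hq (dotProduct_self_nonneg' q) (by positivity)
      _ = (a * b * X) ^ 2 := by ring
  have h2 := abs_le_of_sq_le_sq' h (by positivity)
  rw [add_dotProduct, dotProduct_add, dotProduct_add, dotProduct_comm q p]
  nlinarith [h2.2]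

/-- Bernoulli bounds `1 + t l` by `(1 + l) ^ t`, and `(1 - l)(1 + l) ≤ 1`. -/
theorem one_sub_pow_mul_le {l : ℝ} (hl0 : 0 ≤ l) (hl1 : l ≤ 1) (t : ℕ) :
    (1 - l) ^ t * (1 + t * l) ≤ 1 := by
  have h1 : 1 + t * l ≤ (1 + l) ^ t := one_add_mul_le_pow (by linarith) t
  calc (1 - l) ^ t * (1 + t * l) ≤ (1 - l) ^ t * (1 + l) ^ t :=
        mul_le_mul_of_nonneg_left h1 (pow_nonneg (by linarith) t)
    _ = (1 - l ^ 2) ^ t := by rw [← mul_pow]; ring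
    _ ≤ 1 := pow_le_one₀ (by nlinarith) (by nlinarith)

theorem one_sub_one_sub_pow_le {l : ℝ} (hl0 : 0 ≤ l) (hl1 : l ≤ 1) {t : ℕ} (ht : 0 < t) :
    1 - (1 - l) ^ t ≤ 2 * (l / (l + 1 / t)) := by
  have ht' : (0 : ℝ) < t := by exact_mod_cast ht
  have e : l / (l + 1 / t) = t * l / (t * l + 1) := by
    field_simp
  have h0 : 0 ≤ t * l := by positivity
  rw [e, ← mul_div_assoc, le_div_iff₀ (by positivity)]
  have h1 : 1 + t * (-l) ≤ (1 + -l) ^ t := one_add_mul_le_pow (by linarith) t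
  have h2 : 0 ≤ (1 - l) ^ t := pow_nonneg (by linarith) t
  rw [← sub_eq_add_neg] at h1
  -- Below `1`, Bernoulli gives `1 - (1 - l) ^ t ≤ t l`; above `1`, the trivial bound by `1`
  -- suffices.
  rcases le_total (t * l) 1 with h | h <;> nlinarith

variable [DecidableEq ι]

set_option linter.unusedSectionVars false

theorem exists_transpose_mul_self {A : Matrix ι ι ℝ} (hAs : Aᵀ = A)
    (hA : ∀ v, 0 ≤ v ⬝ᵥ (A *ᵥ v)) : ∃ S : Matrix ι ι ℝ, Sᵀ * S = A := by
  obtain ⟨u, l, hu⟩ := exists_isEigenbasis hAs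
  have hl : ∀ j, 0 ≤ l j := fun j => by
    rw [hu.eigenvalue_eq]
    exact hA _
  refine ⟨Matrix.of fun j i => √(l j) * u j i, ?_⟩
  ext i k
  have h := hu.parseval (Pi.single i 1) (A *ᵥ Pi.single k 1)
  simp only [dotProduct_mulVec_symm hAs, hu.mulVec_eq, dotProduct_single_one,
    Pi.smul_apply, smul_eq_mul] at h
  have e : A i k = (A *ᵥ Pi.single i 1) k := by
    rw [Matrix.mulVec_single_one]
    exact congrFun (congrFun hAs.symm i) k
  rw [← e] at h
  rw [Matrix.mul_apply]
  refine Eq.trans (Finset.sum_congr rfl fun j _ => ?_) h.symm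
  simp only [Matrix.transpose_apply, Matrix.of_apply]
  linear_combination (u j i * u j k) * Real.mul_self_sqrt (hl j)

/-- The operator `H` is the ridge regression smoother `B (B + a)⁻¹` of the positive semidefinite
matrix `B`. -/
structure IsRidge (B H : Matrix ι ι ℝ) (a : ℝ) : Prop where
  pos : 0 < a
  symm_gram : Bᵀ = B
  nonneg : ∀ v, 0 ≤ v ⬝ᵥ (B *ᵥ v)
  symm : Hᵀ = H
  mul_eq : H * B + a • H = B

namespace IsRidge

variable {B H : Matrix ι ι ℝ} {a : ℝ}

theorem gram_mulVec_sub (h : IsRidge B H a) (u : ι → ℝ) :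
    B *ᵥ (u - H *ᵥ u) = a • (H *ᵥ u) := by
  have e := congrArg Matrix.transpose h.mul_eq
  rw [Matrix.transpose_add, Matrix.transpose_mul, Matrix.transpose_smul, h.symm, h.symm_gram] at e
  rw [Matrix.mulVec_sub, Matrix.mulVec_mulVec]
  nth_rewrite 1 [← e]
  rw [Matrix.add_mulVec, Matrix.smul_mulVec, add_sub_cancel_left]

/-- The ridge smoother attains the infimal convolution of the quadratic forms of `B` and `a`. -/
theorem infConv_eq (h : IsRidge B H a) (u : ι → ℝ) :
    (u - H *ᵥ u) ⬝ᵥ (B *ᵥ (u - H *ᵥ u)) + a * ((H *ᵥ u) ⬝ᵥ (H *ᵥ u)) =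
      a * (u ⬝ᵥ (H *ᵥ u)) := by
  rw [h.gram_mulVec_sub, dotProduct_smul, sub_dotProduct, smul_eq_mul]
  ring

theorem sq_le (h : IsRidge B H a) (u : ι → ℝ) :
    (H *ᵥ u) ⬝ᵥ (H *ᵥ u) ≤ u ⬝ᵥ (H *ᵥ u) := by
  have h1 := h.infConv_eq u
  have h2 := h.nonneg (u - H *ᵥ u)
  exact le_of_mul_le_mul_left (by linarith) h.pos

theorem dotProduct_nonneg (h : IsRidge B H a) (u : ι → ℝ) : 0 ≤ u ⬝ᵥ (H *ᵥ u) :=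
  (dotProduct_self_nonneg' _).trans (h.sq_le u)

theorem dotProduct_le (h : IsRidge B H a) (u : ι → ℝ) : u ⬝ᵥ (H *ᵥ u) ≤ u ⬝ᵥ u := by
  have h1 := h.sq_le u
  have h2 := dotProduct_self_nonneg' (u - H *ᵥ u)
  rw [sub_dotProduct, dotProduct_sub, dotProduct_sub, dotProduct_comm (H *ᵥ u) u] at h2
  linarith

theorem exists_factor (h : IsRidge B H a) : ∃ S : Matrix ι ι ℝ, Sᵀ * S = H :=
  exists_transpose_mul_self h.symm h.dotProduct_nonneg

end IsRidge

theorem IsEigenbasis.one_sub_pow_mulVec {C : Matrix ι ι ℝ} {u : ι → ι → ℝ} {l : ι → ℝ}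
    (h : IsEigenbasis C u l) (t : ℕ) (j : ι) :
    ((1 - C) ^ t) *ᵥ u j = (1 - l j) ^ t • u j := by
  induction t with
  | zero => simp
  | succ t ih =>
    rw [pow_succ, ← Matrix.mulVec_mulVec, Matrix.sub_mulVec, h.mulVec_eq, Matrix.one_mulVec,
      Matrix.mulVec_sub, Matrix.mulVec_smul, ih, smul_smul, ← sub_smul]
    congr 1
    ring

theorem one_sub_pow_transpose {C : Matrix ι ι ℝ} (hC : Cᵀ = C) (t : ℕ) :
    ((1 - C) ^ t)ᵀ = (1 - C) ^ t :=
  pow_transpose_eq (by rw [Matrix.transpose_sub, hC, Matrix.transpose_one]) t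

/-- The variance of gradient descent on a smaller Gram matrix is at most four times that of ridge
regression. -/
theorem trace_gradientDescent_sq_le {B C H : Matrix ι ι ℝ} {t : ℕ} (ht : 0 < t)
    (h : IsRidge B H (1 / t)) (hCs : Cᵀ = C) (hC : ∀ v, 0 ≤ v ⬝ᵥ (C *ᵥ v))
    (hCB : ∀ v, v ⬝ᵥ (C *ᵥ v) ≤ v ⬝ᵥ (B *ᵥ v)) (hC1 : ∀ v, v ⬝ᵥ (C *ᵥ v) ≤ v ⬝ᵥ v) :
    ((1 - (1 - C) ^ t) * (1 - (1 - C) ^ t)).trace ≤ 4 * (H * H).trace := by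
  obtain ⟨u, l, hu⟩ := exists_isEigenbasis hCs
  rw [hu.trace_eq, hu.trace_eq, Finset.mul_sum]
  refine Finset.sum_le_sum fun j _ => ?_
  have hl0 : 0 ≤ l j := by rw [hu.eigenvalue_eq]; exact hC _
  have hl1 : l j ≤ 1 := by rw [hu.eigenvalue_eq, ← hu.norm_eq j]; exact hC1 _
  have e : (1 - (1 - C) ^ t) *ᵥ u j = (1 - (1 - l j) ^ t) • u j := by
    rw [Matrix.sub_mulVec, hu.one_sub_pow_mulVec, Matrix.one_mulVec, sub_smul, one_smul]
  rw [← Matrix.mulVec_mulVec, e, Matrix.mulVec_smul, e, smul_smul, dotProduct_smul, hu.norm_eq,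
    ← Matrix.mulVec_mulVec, dotProduct_mulVec_symm h.symm, smul_eq_mul, mul_one]
  have h1 := one_sub_one_sub_pow_le hl0 hl1 ht
  have h2 := eigen_infConv_le hCs hC h.pos (hu.mulVec_eq j) (hu.norm_eq j) (H *ᵥ u j)
  -- Monotonicity of `X ↦ X (X + a)⁻¹` in the form needed here: the infimal convolution for `C` lies
  -- below the one for `B`, which `H` attains.
  have h3 : l j / (l j + 1 / t) ≤ u j ⬝ᵥ (H *ᵥ u j) := by
    refine le_of_mul_le_mul_left ?_ h.pos
    rw [← h.infConv_eq, ← mul_div_assoc]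
    exact h2.trans (add_le_add_left (hCB _) _)
  have h4 := dotProduct_sq_le (u j) (H *ᵥ u j)
  rw [hu.norm_eq, one_mul] at h4
  have h5 : 0 ≤ 1 - (1 - l j) ^ t :=
    sub_nonneg.2 (pow_le_one₀ (by linarith) (by linarith))
  nlinarith

/-- The bias of gradient descent on a smaller Gram matrix `C`, compared with ridge regression. -/
theorem gradientDescent_bias_le {B C H : Matrix ι ι ℝ} {t : ℕ} (ht : 0 < t)
    (h : IsRidge B H (1 / t)) (hCs : Cᵀ = C) (hC : ∀ v, 0 ≤ v ⬝ᵥ (C *ᵥ v))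
    (hC1 : ∀ v, v ⬝ᵥ (C *ᵥ v) ≤ v ⬝ᵥ v) {b : ℝ} (hb : 0 ≤ b)
    (hD : ∀ x, ((B - C) *ᵥ x) ⬝ᵥ ((B - C) *ᵥ x) ≤ b ^ 2 * (x ⬝ᵥ x)) (v : ι → ℝ) :
    ((1 - C) ^ t *ᵥ v) ⬝ᵥ ((1 - C) ^ t *ᵥ v) ≤
      (1 + b * t) ^ 2 * ((v - H *ᵥ v) ⬝ᵥ (v - H *ᵥ v)) := by
  obtain ⟨u, l, hu⟩ := exists_isEigenbasis hCs
  have ht' : (0 : ℝ) < t := by exact_mod_cast ht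
  have hl0 : ∀ j, 0 ≤ l j := fun j => by rw [hu.eigenvalue_eq]; exact hC _
  have hl1 : ∀ j, l j ≤ 1 := fun j => by
    rw [hu.eigenvalue_eq, ← hu.norm_eq j]; exact hC1 _
  -- `x = (B + 1/t)⁻¹ v`. Splitting `B = C + (B - C)` separates the part controlled by the spectrum
  -- of `C` from the Nyström error.
  set x := (t : ℝ) • (v - H *ᵥ v) with hx
  have hv : v = (C + (1 / t : ℝ) • 1) *ᵥ x + (B - C) *ᵥ x := by
    rw [← Matrix.add_mulVec, add_right_comm, add_sub_cancel, Matrix.add_mulVec, hx,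
      Matrix.mulVec_smul, h.gram_mulVec_sub, Matrix.smul_mulVec, Matrix.one_mulVec, smul_smul,
      smul_smul, mul_one_div_cancel ht'.ne', one_div_mul_cancel ht'.ne', one_smul, one_smul,
      add_sub_cancel]
  have hGs := one_sub_pow_transpose hCs t
  have hG1 := hu.mulVec_sq_le hGs (hu.one_sub_pow_mulVec t) (c := 1) fun j => by
    rw [abs_of_nonneg (pow_nonneg (by linarith [hl1 j]) t)]
    exact pow_le_one₀ (by linarith [hl1 j]) (by linarith [hl0 j])
  have hcomm : (1 - C) ^ t * (C + (1 / t : ℝ) • 1) = (C + (1 / t : ℝ) • 1) * (1 - C) ^ t := by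
    refine Commute.eq (Commute.pow_left ?_ t)
    rw [Commute, SemiconjBy]
    simp only [Matrix.mul_add, Matrix.add_mul, Matrix.sub_mul, Matrix.mul_sub, Matrix.one_mul,
      Matrix.mul_one, Matrix.mul_smul, Matrix.smul_mul, smul_sub]
    abel
  have hG2 := hu.mulVec_sq_le (F := (1 - C) ^ t * (C + (1 / t : ℝ) • 1)) (by
      rw [Matrix.transpose_mul, hGs, Matrix.transpose_add, hCs, Matrix.transpose_smul,
        Matrix.transpose_one, hcomm])
    (f := fun j => (1 - l j) ^ t * (l j + 1 / t)) (fun j => by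
      rw [← Matrix.mulVec_mulVec, Matrix.add_mulVec, hu.mulVec_eq, Matrix.smul_mulVec,
        Matrix.one_mulVec, ← add_smul, Matrix.mulVec_smul, hu.one_sub_pow_mulVec, smul_smul,
        mul_comm]) (c := 1 / t) (fun j => by
      have h0 := hl0 j
      rw [abs_of_nonneg (mul_nonneg (pow_nonneg (by linarith [hl1 j]) t) (by positivity)),
        le_div_iff₀ ht', mul_assoc, add_mul, one_div_mul_cancel ht'.ne', add_comm, mul_comm (l j)]
      exact one_sub_pow_mul_le (hl0 j) (hl1 j) t)
  have h1 := hG2 x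
  have h2 := (hG1 ((B - C) *ᵥ x)).trans (mul_le_mul_of_nonneg_left (hD x) (by norm_num))
  rw [one_pow, one_mul] at h2
  have h3 := add_dotProduct_add_le (by positivity) hb (dotProduct_self_nonneg' x) h1 h2
  rw [← Matrix.mulVec_mulVec, ← Matrix.mulVec_add, ← hv] at h3
  refine h3.trans (le_of_eq ?_)
  rw [hx, smul_dotProduct, dotProduct_smul, smul_eq_mul, smul_eq_mul]
  field_simp

theorem mulVec_sq_le_of_eigenvalue_le {D : Matrix ι ι ℝ} (hDs : Dᵀ = D)
    (hD : ∀ v, 0 ≤ v ⬝ᵥ (D *ᵥ v)) {b : ℝ}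
    (h : ∀ v l, D *ᵥ v = l • v → v ⬝ᵥ v = 1 → l ≤ b) (x : ι → ℝ) :
    (D *ᵥ x) ⬝ᵥ (D *ᵥ x) ≤ b ^ 2 * (x ⬝ᵥ x) := by
  obtain ⟨u, l, hu⟩ := exists_isEigenbasis hDs
  refine hu.mulVec_sq_le hDs hu.mulVec_eq (fun j => ?_) x
  rw [abs_of_nonneg (by rw [hu.eigenvalue_eq]; exact hD _)]
  exact h _ _ (hu.mulVec_eq j) (hu.norm_eq j)

theorem residualProj_mulVec_sq_le {S : Matrix ι ι ℝ} {M : Finset ι} {p : ℕ}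
    (hZ : (residualGram S M ^ p).trace < (1 / 2) ^ p) (v : ι → ℝ) :
    (residualProj S M *ᵥ (S *ᵥ v)) ⬝ᵥ (residualProj S M *ᵥ (S *ᵥ v)) ≤ 1 / 2 * (v ⬝ᵥ v) := by
  obtain ⟨u, l, hu⟩ := exists_isEigenbasis (residualGram_transpose S M)
  have hQ := isResidualProj_residualProj S M
  have hl0 : ∀ j, 0 ≤ l j := fun j => by
    rw [hu.eigenvalue_eq]
    exact dotProduct_residualGram_nonneg S _ _
  have hl : ∀ j, l j ≤ 1 / 2 := fun j => by
    refine (lt_of_pow_lt_pow_left₀ p (by norm_num) (lt_of_le_of_lt ?_ hZ)).le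
    rw [hu.trace_pow]
    exact Finset.single_le_sum (f := fun i => l i ^ p) (fun i _ => pow_nonneg (hl0 i) p)
      (Finset.mem_univ j)
  set y := residualProj S M *ᵥ (S *ᵥ v) with hy
  have h1 : y ⬝ᵥ (residualGram S M *ᵥ y) ≤ 1 / 2 * (y ⬝ᵥ y) := by
    rw [hu.dotProduct_mulVec_eq (residualGram_transpose S M) hu.mulVec_eq, hu.parseval,
      Finset.mul_sum]
    refine Finset.sum_le_sum fun j _ => ?_
    rw [sq]
    exact mul_le_mul_of_nonneg_right (hl j) (mul_self_nonneg _)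
  -- Cauchy-Schwarz on this identity carries the bound from `Q S Sᵀ Q` to `Sᵀ Q S`.
  have h2 : y ⬝ᵥ y = (Sᵀ *ᵥ (residualProj S M *ᵥ y)) ⬝ᵥ v := by
    conv_lhs => rw [hy]
    rw [← dotProduct_mulVec_symm hQ.symm, hy, Matrix.mulVec_transpose, ← Matrix.dotProduct_mulVec,
      dotProduct_comm]
  have h3 := dotProduct_sq_le (Sᵀ *ᵥ (residualProj S M *ᵥ y)) v
  rw [← h2, ← dotProduct_residualGram_mulVec] at h3
  have h4 := dotProduct_self_nonneg' v
  have h5 := dotProduct_self_nonneg' y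
  by_contra hlt
  push Not at hlt
  nlinarith [mul_le_mul_of_nonneg_right h1 h4]

/-- If the residual of the ridge smoother after the pivots `M` is small, then the Nyström residual
`D` is below the regularization. -/
theorem eigenvalue_le_of_trace_residualGram_lt {B H D S : Matrix ι ι ℝ} {a : ℝ}
    (h : IsRidge B H a) (hDs : Dᵀ = D) (hD : ∀ v, 0 ≤ v ⬝ᵥ (D *ᵥ v)) {M : Finset ι}
    (hSchur : ∀ v w : ι → ℝ, (∀ i, i ∉ M → w i = 0) →
      v ⬝ᵥ (D *ᵥ v) ≤ (v - w) ⬝ᵥ (B *ᵥ (v - w)))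
    (hS : Sᵀ * S = H) {p : ℕ} (hZ : (residualGram S M ^ p).trace < (1 / 2) ^ p)
    {v : ι → ℝ} {l : ℝ} (hv : D *ᵥ v = l • v) (hv1 : v ⬝ᵥ v = 1) : l ≤ a := by
  have hl : 0 ≤ l := by
    have := hD v
    rwa [hv, dotProduct_smul, hv1, smul_eq_mul, mul_one] at this
  have ha := h.pos
  obtain ⟨w, hw, e⟩ := (isResidualProj_residualProj S M).exists_coeff (S *ᵥ v)
  have h1 := residualProj_mulVec_sq_le hZ v
  have h2 : residualProj S M *ᵥ (S *ᵥ v) = S *ᵥ (v - w) := by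
    rw [Matrix.mulVec_sub, ← e, sub_sub_cancel]
  have h3 : (S *ᵥ (v - w)) ⬝ᵥ (S *ᵥ (v - w)) = (v - w) ⬝ᵥ (H *ᵥ (v - w)) := by
    rw [← hS, ← Matrix.mulVec_mulVec, Matrix.dotProduct_mulVec (v - w), Matrix.vecMul_transpose]
  rw [h2, h3, hv1] at h1
  -- The test point `z = H (v - w)` is the ridge minimizer at `v - w`. The Schur bound absorbs `w`,
  -- so `a l / (l + a)` is at most `a (v - w)ᵀ H (v - w) ≤ a / 2`, that is, `l ≤ a`.
  have h4 := hSchur (v - H *ᵥ (v - w)) w hw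
  rw [sub_right_comm] at h4
  have h5 := eigen_infConv_le hDs hD ha hv hv1 (H *ᵥ (v - w))
  have h6 := h.infConv_eq (v - w)
  have h7 : a * l / (l + a) ≤ a * (1 / 2) := by nlinarith
  rw [div_le_iff₀ (by positivity), mul_assoc] at h7
  have := le_of_mul_le_mul_left h7 ha
  linarith

/-- The bias of gradient descent for the Nyström approximation with pivots `M`. -/
theorem nystrom_bias_le {B C H S : Matrix ι ι ℝ} {t : ℕ} (ht : 0 < t)
    (h : IsRidge B H (1 / t)) (hCs : Cᵀ = C) (hC : ∀ v, 0 ≤ v ⬝ᵥ (C *ᵥ v))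
    (hCB : ∀ v, v ⬝ᵥ (C *ᵥ v) ≤ v ⬝ᵥ (B *ᵥ v)) {b : ℝ} (hb0 : 0 ≤ b) (hb1 : b ≤ 1)
    (hB : ∀ v, v ⬝ᵥ (B *ᵥ v) ≤ b * (v ⬝ᵥ v)) {M : Finset ι}
    (hSchur : ∀ v w : ι → ℝ, (∀ i, i ∉ M → w i = 0) →
      v ⬝ᵥ ((B - C) *ᵥ v) ≤ (v - w) ⬝ᵥ (B *ᵥ (v - w)))
    (hS : Sᵀ * S = H) (p : ℕ) (v : ι → ℝ) :
    ((1 - C) ^ t *ᵥ v) ⬝ᵥ ((1 - C) ^ t *ᵥ v) ≤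
      (4 + (1 + b * t) ^ 2 * 2 ^ p * (residualGram S M ^ p).trace) *
        ((v - H *ᵥ v) ⬝ᵥ (v - H *ᵥ v)) := by
  have ht' : (0 : ℝ) < t := by exact_mod_cast ht
  have hDs : (B - C)ᵀ = B - C := by rw [Matrix.transpose_sub, h.symm_gram, hCs]
  have hD : ∀ v, 0 ≤ v ⬝ᵥ ((B - C) *ᵥ v) := fun v => by
    rw [Matrix.sub_mulVec, dotProduct_sub]
    exact sub_nonneg.2 (hCB v)
  have hC1 : ∀ v, v ⬝ᵥ (C *ᵥ v) ≤ v ⬝ᵥ v := fun v =>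
    ((hCB v).trans (hB v)).trans (mul_le_of_le_one_left (dotProduct_self_nonneg' v) hb1)
  have hnn := dotProduct_self_nonneg' (v - H *ᵥ v)
  have hZ0 := trace_residualGram_pow_nonneg S M p
  by_cases hZ : (residualGram S M ^ p).trace < (1 / 2) ^ p
  · refine (gradientDescent_bias_le ht h hCs hC hC1 h.pos.le
      (mulVec_sq_le_of_eigenvalue_le hDs hD fun v l hv hv1 =>
        eigenvalue_le_of_trace_residualGram_lt h hDs hD hSchur hS hZ hv hv1) v).trans ?_
    refine mul_le_mul_of_nonneg_right ?_ hnn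
    rw [one_div_mul_cancel ht'.ne']
    have : 0 ≤ (1 + b * t) ^ 2 * 2 ^ p * (residualGram S M ^ p).trace := by positivity
    linarith
  · refine (gradientDescent_bias_le ht h hCs hC hC1 hb0
      (mulVec_sq_le_of_eigenvalue_le hDs hD fun v l hv hv1 => ?_) v).trans ?_
    · have h1 := hB v
      have h2 := hC v
      have h3 : v ⬝ᵥ ((B - C) *ᵥ v) = l := by
        rw [hv, dotProduct_smul, hv1, smul_eq_mul, mul_one]
      rw [Matrix.sub_mulVec, dotProduct_sub] at h3
      rw [hv1] at h1
      linarith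
    · refine mul_le_mul_of_nonneg_right ?_ hnn
      push Not at hZ
      -- Markov's inequality before averaging: on the bad event the moment term alone pays for the
      -- crude bound.
      have h1 : 1 ≤ 2 ^ p * (residualGram S M ^ p).trace := by
        have := mul_le_mul_of_nonneg_left hZ (by positivity : (0 : ℝ) ≤ 2 ^ p)
        rwa [← mul_pow, mul_one_div_cancel two_ne_zero, one_pow] at this
      rw [mul_assoc]
      nlinarith [sq_nonneg (1 + b * t)]

end BiasVariance

/-! ### Numerical failure bound, the ridge smoother and the Nyström Schur complement -/

section Kernel

/-- With `L = log (n t / δ)` and `p = ⌈2 L⌉`, the threshold `c = 1/6` gives `2 ^ p c ^ p = 3 ^ (-p)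
≤ e ^ (-2L)`. The sampling term is at most `e ^ (2L + 1 - 16 L / 3) ≤ 3 e ^ (-2L)`. As `1 + t/n ≤
3t/2`, the total is at most `9 δ² / n`. -/
theorem failure_bound {n t : ℕ} (hn : 1 ≤ n) (ht : 2 ≤ t) {δ : ℝ} (hδ0 : 0 < δ) (hδ1 : δ < 1) :
    (1 + 1 / (n : ℝ) * t) ^ 2 * 2 ^ ⌈2 * Real.log (n * t / δ)⌉₊ *
      (n * ((1 / 6) ^ ⌈2 * Real.log (n * t / δ)⌉₊ +
        Real.exp (-(1 / 6 * (32 * Real.log (n * t / δ)))))) ≤ 16 * δ := by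
  have hn' : (1 : ℝ) ≤ n := by exact_mod_cast hn
  have ht' : (2 : ℝ) ≤ t := by exact_mod_cast ht
  have hn0 : (0 : ℝ) < n := by linarith
  have ht0 : (0 : ℝ) < t := by linarith
  set N : ℝ := n * t / δ with hN
  have hN1 : 1 ≤ N := by
    rw [hN, le_div_iff₀ hδ0]
    nlinarith
  have hN0 : 0 < N := by linarith
  set L := Real.log N with hL
  have hL0 : 0 ≤ L := Real.log_nonneg hN1
  set p := ⌈2 * L⌉₊ with hp
  have hp1 : 2 * L ≤ p := Nat.le_ceil _
  have hp2 : (p : ℝ) < 2 * L + 1 := Nat.ceil_lt_add_one (by positivity)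
  have he : Real.exp 1 < 3 := Real.exp_one_lt_three
  have he2 : (2 : ℝ) ≤ Real.exp 1 := by linarith [Real.add_one_le_exp (1 : ℝ)]
  have hexp : Real.exp (-(2 * L)) = (1 / N) ^ 2 := by
    rw [show -(2 * L) = (2 : ℕ) * (-L) by push_cast; ring, Real.exp_nat_mul, Real.exp_neg, hL,
      Real.exp_log hN0, one_div]
  have h1 : (2 : ℝ) ^ p * (1 / 6) ^ p ≤ Real.exp (-(2 * L)) := by
    rw [← mul_pow]
    calc ((2 : ℝ) * (1 / 6)) ^ p ≤ (Real.exp (-1)) ^ p := by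
          refine pow_le_pow_left₀ (by norm_num) ?_ p
          rw [Real.exp_neg, ← one_div, le_div_iff₀ (Real.exp_pos 1)]
          linarith
      _ = Real.exp (p * (-1)) := (Real.exp_nat_mul _ _).symm
      _ ≤ Real.exp (-(2 * L)) := Real.exp_le_exp.2 (by linarith)
  have h2 : (2 : ℝ) ^ p * Real.exp (-(1 / 6 * (32 * L))) ≤ 3 * Real.exp (-(2 * L)) := by
    calc (2 : ℝ) ^ p * Real.exp (-(1 / 6 * (32 * L)))
        ≤ (Real.exp 1) ^ p * Real.exp (-(1 / 6 * (32 * L))) :=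
          mul_le_mul_of_nonneg_right (pow_le_pow_left₀ (by norm_num) he2 p) (Real.exp_pos _).le
      _ = Real.exp (p * 1 + -(1 / 6 * (32 * L))) := by rw [Real.exp_add, Real.exp_nat_mul]
      _ ≤ Real.exp (1 + -(2 * L)) := Real.exp_le_exp.2 (by linarith)
      _ = Real.exp 1 * Real.exp (-(2 * L)) := Real.exp_add _ _
      _ ≤ 3 * Real.exp (-(2 * L)) := mul_le_mul_of_nonneg_right he.le (Real.exp_pos _).le
  have h3 : (1 + 1 / (n : ℝ) * t) ≤ 3 / 2 * t := by
    have : 1 / (n : ℝ) ≤ 1 := (div_le_one hn0).2 hn'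
    rcases hn.eq_or_lt with rfl | hn2
    · simp only [Nat.cast_one, div_one, one_mul]
      linarith
    · have hn2' : (2 : ℝ) ≤ n := by exact_mod_cast hn2
      have : 1 / (n : ℝ) ≤ 1 / 2 := one_div_le_one_div_of_le two_pos hn2'
      nlinarith
  have h4 : (1 + 1 / (n : ℝ) * t) ^ 2 ≤ (3 / 2 * t) ^ 2 :=
    pow_le_pow_left₀ (by positivity) h3 2
  calc (1 + 1 / (n : ℝ) * t) ^ 2 * 2 ^ p * (n * ((1 / 6) ^ p + Real.exp (-(1 / 6 * (32 * L)))))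
      = (1 + 1 / (n : ℝ) * t) ^ 2 * n *
        (2 ^ p * (1 / 6) ^ p + 2 ^ p * Real.exp (-(1 / 6 * (32 * L)))) := by ring
    _ ≤ (3 / 2 * t) ^ 2 * n * (4 * (1 / N) ^ 2) := by
        rw [← hexp]
        refine mul_le_mul (mul_le_mul_of_nonneg_right h4 hn0.le) (by linarith) (by positivity)
          (by positivity)
    _ = 9 * δ ^ 2 / n := by
        rw [hN]
        field_simp
        norm_num
    _ ≤ 9 * δ ^ 2 := div_le_self (by positivity) hn'
    _ ≤ 16 * δ := by nlinarith

variable {n : ℕ}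

theorem dotProduct_mulVec_le_opNorm (A : Matrix (Fin n) (Fin n) ℝ) (v : Fin n → ℝ) :
    v ⬝ᵥ (A *ᵥ v) ≤ opNorm A * (v ⬝ᵥ v) := by
  have h1 : v ⬝ᵥ (A *ᵥ v) =
      inner ℝ (WithLp.toLp 2 v) (Matrix.toEuclideanCLM (𝕜 := ℝ) A (WithLp.toLp 2 v)) := by
    simp [PiLp.inner_apply, dotProduct, mul_comm]
  have h2 : v ⬝ᵥ v = ‖(WithLp.toLp 2 v : EuclideanSpace ℝ (Fin n))‖ ^ 2 := by
    rw [EuclideanSpace.norm_sq_eq]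
    simp [dotProduct, sq]
  rw [h1, h2, opNorm, sq, ← mul_assoc]
  refine (real_inner_le_norm _ _).trans ?_
  rw [mul_comm]
  exact mul_le_mul_of_nonneg_right (ContinuousLinearMap.le_opNorm _ _) (norm_nonneg _)

theorem opNorm_pos {A : Matrix (Fin n) (Fin n) ℝ} (hA : A ≠ 0) : 0 < opNorm A := by
  rw [opNorm, norm_pos_iff]
  simpa using hA

/-- The smoother of kernel regularized least squares, in normalized form. -/
theorem isRidge_smoother {A : Matrix (Fin n) (Fin n) ℝ} (hAs : Aᵀ = A)
    (hA : ∀ v, 0 ≤ v ⬝ᵥ (A *ᵥ v)) (hn : 0 < n) {γ τ : ℝ} (hγ : 0 < γ) (hτ : 0 < τ) :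
    IsRidge ((γ / n) • A)
      (A * (A + (1 / (γ * τ) * n) • (1 : Matrix (Fin n) (Fin n) ℝ))⁻¹) (1 / τ) := by
  have hn' : (0 : ℝ) < n := by exact_mod_cast hn
  set c : ℝ := 1 / (γ * τ) * n with hc
  have hc0 : 0 < c := by positivity
  set G := A + c • (1 : Matrix (Fin n) (Fin n) ℝ) with hG
  have hdet : IsUnit G.det := by
    rw [isUnit_iff_ne_zero]
    intro h0
    obtain ⟨v, hv, e⟩ := Matrix.exists_mulVec_eq_zero_iff.2 h0
    have h1 : v ⬝ᵥ (G *ᵥ v) = 0 := by rw [e, dotProduct_zero]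
    rw [hG, Matrix.add_mulVec, Matrix.smul_mulVec, Matrix.one_mulVec, dotProduct_add,
      dotProduct_smul, smul_eq_mul] at h1
    have h2 := dotProduct_self_nonneg' v
    have h3 : v ⬝ᵥ v = 0 := by nlinarith [hA v]
    exact hv (dotProduct_self_eq_zero.1 h3)
  have hGs : Gᵀ = G := by
    rw [hG, Matrix.transpose_add, hAs, Matrix.transpose_smul, Matrix.transpose_one]
  have hcomm : G * A = A * G := by
    rw [hG, Matrix.add_mul, Matrix.mul_add, Matrix.smul_mul, Matrix.mul_smul, Matrix.one_mul,
      Matrix.mul_one]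
  have hHG : A * G⁻¹ * G = A := Matrix.nonsing_inv_mul_cancel_right _ _ hdet
  refine ⟨by positivity, by rw [Matrix.transpose_smul, hAs], fun v => ?_, ?_, ?_⟩
  · rw [Matrix.smul_mulVec, dotProduct_smul, smul_eq_mul]
    exact mul_nonneg (by positivity) (hA v)
  · rw [Matrix.transpose_mul, hAs, Matrix.transpose_nonsing_inv, hGs]
    calc G⁻¹ * A = G⁻¹ * (A * G * G⁻¹) := by rw [Matrix.mul_nonsing_inv_cancel_right _ _ hdet]
      _ = G⁻¹ * (G * A * G⁻¹) := by rw [hcomm]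
      _ = A * G⁻¹ := by rw [Matrix.mul_assoc G, Matrix.nonsing_inv_mul_cancel_left _ _ hdet]
  -- Scaling by `γ / n` turns the ridge shift `λ n`, with `λ = 1 / (γ τ)`, into `1 / τ`.
  · have e : (1 / τ : ℝ) = γ / n * c := by
      rw [hc]
      field_simp
    rw [e, Matrix.mul_smul, mul_smul, ← smul_add]
    congr 1
    conv_rhs => rw [← hHG, hG, Matrix.mul_add, Matrix.mul_smul, Matrix.mul_one]

section Nystrom

variable {ι κ : Type*} [Fintype ι] [DecidableEq ι] [Fintype κ]

set_option linter.unusedSectionVars false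

theorem mul_transpose_dotProduct_nonneg (A : Matrix ι κ ℝ) (v : ι → ℝ) :
    v ⬝ᵥ ((A * Aᵀ) *ᵥ v) = (Aᵀ *ᵥ v) ⬝ᵥ (Aᵀ *ᵥ v) := by
  rw [← Matrix.mulVec_mulVec, Matrix.dotProduct_mulVec v, ← Matrix.mulVec_transpose]

/-- The quadratic form of the Schur complement, for any factor of the pseudoinverse of the block
of pivots. -/
theorem nystrom_residual {A : Matrix ι ι ℝ} (hAs : Aᵀ = A) (hA : ∀ v, 0 ≤ v ⬝ᵥ (A *ᵥ v))
    {M : Finset ι} {R : Matrix M κ ℝ}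
    (hR : IsPseudoinverse (A.submatrix ((↑) : M → ι) ((↑) : M → ι)) (R * Rᵀ)) (v w : ι → ℝ)
    (hw : ∀ i, i ∉ M → w i = 0) :
    0 ≤ v ⬝ᵥ ((A - (A.submatrix id ((↑) : M → ι) * R) * (A.submatrix id ((↑) : M → ι) * R)ᵀ)
      *ᵥ v) ∧
    v ⬝ᵥ ((A - (A.submatrix id ((↑) : M → ι) * R) * (A.submatrix id ((↑) : M → ι) * R)ᵀ) *ᵥ v) ≤
      (v - w) ⬝ᵥ (A *ᵥ (v - w)) := by
  obtain ⟨F, hF⟩ := exists_transpose_mul_self hAs hA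
  set Y : Matrix ι M ℝ := F.submatrix id (↑) with hY
  have hcross : A.submatrix id ((↑) : M → ι) = Fᵀ * Y := by
    rw [← hF]
    rfl
  have hsub : A.submatrix ((↑) : M → ι) ((↑) : M → ι) = Yᵀ * Y := by
    rw [← hF]
    rfl
  rw [hsub] at hR
  rw [hcross]
  obtain ⟨G, hG⟩ : ∃ G, G = R * Rᵀ := ⟨_, rfl⟩
  rw [← hG] at hR
  have hGs : Gᵀ = G := by rw [hG, Matrix.transpose_mul, Matrix.transpose_transpose]
  -- `P` is the orthogonal projection onto the columns of `Y`, whichever factor of the pseudoinverse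
  -- is used. The Nyström residual is then `Fᵀ (1 - P) F`, whose quadratic form ignores shifts
  -- supported on `M`.
  obtain ⟨P, hP⟩ : ∃ P, P = Y * G * Yᵀ := ⟨_, rfl⟩
  have hPs : Pᵀ = P := by
    rw [hP, Matrix.transpose_mul, Matrix.transpose_mul, Matrix.transpose_transpose, hGs,
      Matrix.mul_assoc]
  have hPP : P * P = P := by
    calc P * P = Y * (G * (Yᵀ * Y) * G) * Yᵀ := by simp only [hP, Matrix.mul_assoc]
      _ = P := by rw [hR.mul_mul_right, ← hP]
  have hPY : P * Y = Y := by
    have h0 : (Y - P * Y)ᵀ * (Y - P * Y) = 0 := by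
      have e1 : Yᵀ * (P * Y) = Yᵀ * Y := by
        calc Yᵀ * (P * Y) = (Yᵀ * Y) * G * (Yᵀ * Y) := by simp only [hP, Matrix.mul_assoc]
          _ = Yᵀ * Y := hR.mul_mul_left
      have e2 : Yᵀ * P * (P * Y) = Yᵀ * Y := by
        rw [← Matrix.mul_assoc, Matrix.mul_assoc Yᵀ, hPP, Matrix.mul_assoc, e1]
      rw [Matrix.transpose_sub, Matrix.transpose_mul, hPs, Matrix.sub_mul, Matrix.mul_sub,
        Matrix.mul_sub, e1, e2, Matrix.mul_assoc, e1]
      simp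
    have := Matrix.conjTranspose_mul_self_eq_zero.1
      ((Matrix.conjTranspose_eq_transpose_of_trivial (Y - P * Y)).symm ▸ h0)
    exact (sub_eq_zero.1 this).symm
  have hres : A - Fᵀ * Y * R * (Fᵀ * Y * R)ᵀ = Fᵀ * (F - P * F) := by
    rw [Matrix.mul_sub, hF, hP, hG]
    simp only [Matrix.transpose_mul, Matrix.transpose_transpose, Matrix.mul_assoc]
  have hFt : ∀ x y : ι → ℝ, x ⬝ᵥ (Fᵀ *ᵥ y) = (F *ᵥ x) ⬝ᵥ y := by
    intro x y
    rw [Matrix.dotProduct_mulVec, Matrix.vecMul_transpose]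
  have hquad : ∀ y : ι → ℝ, y ⬝ᵥ (y - P *ᵥ y) = (y - P *ᵥ y) ⬝ᵥ (y - P *ᵥ y) := by
    intro y
    have : (P *ᵥ y) ⬝ᵥ (y - P *ᵥ y) = 0 := by
      rw [← dotProduct_mulVec_symm hPs, Matrix.mulVec_sub, Matrix.mulVec_mulVec, hPP, sub_self,
        dotProduct_zero]
    rw [sub_dotProduct, this, sub_zero]
  have hFw : P *ᵥ (F *ᵥ w) = F *ᵥ w := by
    have e : F *ᵥ w = Y *ᵥ fun j : M => w j := by
      ext i
      simp only [Matrix.mulVec, dotProduct, hY, Matrix.submatrix_apply, id_eq]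
      rw [Finset.sum_coe_sort M fun j => F i j * w j]
      refine (Finset.sum_subset (Finset.subset_univ M) fun j _ hj => ?_).symm
      rw [hw j hj, mul_zero]
    rw [e, Matrix.mulVec_mulVec, hPY]
  have hvw : F *ᵥ v - P *ᵥ (F *ᵥ v) = F *ᵥ (v - w) - P *ᵥ (F *ᵥ (v - w)) := by
    rw [Matrix.mulVec_sub, Matrix.mulVec_sub, hFw]
    abel
  rw [hres, ← Matrix.mulVec_mulVec, hFt, Matrix.sub_mulVec, ← Matrix.mulVec_mulVec, hquad]
  refine ⟨dotProduct_self_nonneg' _, ?_⟩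
  rw [hvw, ← hquad, dotProduct_sub, ← hF, ← Matrix.mulVec_mulVec, hFt]
  have : 0 ≤ F *ᵥ (v - w) ⬝ᵥ P *ᵥ (F *ᵥ (v - w)) := by
    rw [← hPP, ← Matrix.mulVec_mulVec, dotProduct_mulVec_symm hPs]
    exact dotProduct_self_nonneg' _
  linarith

end Nystrom

end Kernel

/-! ### Fixed design risk: best approximation and bias-variance decomposition -/

section Risk

/-- The variables `ε i` are centred, square integrable and uncorrelated with variance `s`. -/
structure IsNoise {Ω : Type*} [MeasurableSpace Ω] {n : ℕ} (P : Measure Ω) (ε : Fin n → Ω → ℝ)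
    (s : ℝ) : Prop where
  memLp : ∀ i, MemLp (ε i) 2 P
  integral_eq : ∀ i, ∫ ω, ε i ω ∂P = 0
  integral_mul : ∀ i j, ∫ ω, ε i ω * ε j ω ∂P = if i = j then s else 0

theorem isNoise_of_iIndepFun {Ω : Type*} [MeasurableSpace Ω] {n : ℕ} {P : Measure Ω}
    [IsProbabilityMeasure P] {ρ : Measure ℝ} [IsProbabilityMeasure ρ] {σ : ℝ}
    (hρ : MemLp id 2 ρ) (hmean : ∫ e, e ∂ρ = 0) (hvar : variance id ρ = σ ^ 2)
    {ε : Fin n → Ω → ℝ} (hindep : iIndepFun ε P) (hlaw : ∀ i, HasLaw (ε i) ρ P) :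
    IsNoise P ε (σ ^ 2) := by
  have hmem : ∀ i, MemLp (ε i) 2 P := fun i => by
    have h := hρ
    rw [← (hlaw i).map_eq] at h
    exact (memLp_map_measure_iff h.aestronglyMeasurable (hlaw i).aemeasurable).1 h
  have hint : ∀ i, ∫ ω, ε i ω ∂P = 0 := fun i => by
    rw [(hlaw i).integral_eq, hmean]
  refine ⟨hmem, hint, fun i j => ?_⟩
  split_ifs with hij
  · subst hij
    have h := (hlaw i).variance_eq
    rw [hvar, variance_of_integral_eq_zero (hlaw i).aemeasurable (hint i)] at h
    rw [← h]
    simp only [sq]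
  · have := (hindep.indepFun hij).integral_fun_mul_eq_mul_integral
      (hlaw i).aemeasurable.aestronglyMeasurable (hlaw j).aemeasurable.aestronglyMeasurable
    rw [this, hint i, zero_mul]

set_option linter.unusedSectionVars false

variable {Ω : Type*} [MeasurableSpace Ω] {n : ℕ} {P : Measure Ω} [IsProbabilityMeasure P]
  {ε : Fin n → Ω → ℝ} {s : ℝ}

theorem mulVec_sub_sq_eq (N : Matrix (Fin n) (Fin n) ℝ) (b e : Fin n → ℝ) :
    (N *ᵥ e - b) ⬝ᵥ (N *ᵥ e - b) =
      ∑ j, ∑ k, (Nᵀ * N) j k * (e j * e k) - 2 * ∑ j, (Nᵀ *ᵥ b) j * e j + b ⬝ᵥ b := by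
  have h1 : (N *ᵥ e) ⬝ᵥ (N *ᵥ e) = ∑ j, ∑ k, (Nᵀ * N) j k * (e j * e k) := by
    rw [Matrix.dotProduct_mulVec, ← Matrix.mulVec_transpose, Matrix.mulVec_mulVec]
    simp only [dotProduct, Matrix.mulVec, Finset.sum_mul]
    exact Finset.sum_congr rfl fun j _ => Finset.sum_congr rfl fun k _ => by ring
  have h2 : b ⬝ᵥ (N *ᵥ e) = ∑ j, (Nᵀ *ᵥ b) j * e j := by
    rw [Matrix.dotProduct_mulVec, ← Matrix.mulVec_transpose]
    rfl
  rw [sub_dotProduct, dotProduct_sub, dotProduct_sub, dotProduct_comm (N *ᵥ e) b, h1, h2]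
  ring

theorem IsNoise.integrable_mul (h : IsNoise P ε s) (i j : Fin n) :
    Integrable (fun ω => ε i ω * ε j ω) P :=
  (h.memLp i).integrable_mul (h.memLp j)

theorem IsNoise.integrable (h : IsNoise P ε s) (i : Fin n) : Integrable (ε i) P :=
  (h.memLp i).integrable (by norm_num)

/-- Bias-variance decomposition. -/
theorem IsNoise.biasVariance (h : IsNoise P ε s) (N : Matrix (Fin n) (Fin n) ℝ)
    (b : Fin n → ℝ) :
    Integrable (fun ω => (N *ᵥ (fun i => ε i ω) - b) ⬝ᵥ (N *ᵥ (fun i => ε i ω) - b)) P ∧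
    ∫ ω, (N *ᵥ (fun i => ε i ω) - b) ⬝ᵥ (N *ᵥ (fun i => ε i ω) - b) ∂P =
      b ⬝ᵥ b + s * (Nᵀ * N).trace := by
  simp only [mulVec_sub_sq_eq]
  have i1 : ∀ j k, Integrable (fun ω => (Nᵀ * N) j k * (ε j ω * ε k ω)) P := fun j k =>
    (h.integrable_mul j k).const_mul _
  have i2 : ∀ j, Integrable (fun ω => ∑ k, (Nᵀ * N) j k * (ε j ω * ε k ω)) P := fun j =>
    integrable_finsetSum _ fun k _ => i1 j k
  have i3 : Integrable (fun ω => ∑ j, ∑ k, (Nᵀ * N) j k * (ε j ω * ε k ω)) P :=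
    integrable_finsetSum _ fun j _ => i2 j
  have i4 : ∀ j, Integrable (fun ω => (Nᵀ *ᵥ b) j * ε j ω) P := fun j =>
    (h.integrable j).const_mul _
  have i5 : Integrable (fun ω => 2 * ∑ j, (Nᵀ *ᵥ b) j * ε j ω) P :=
    (integrable_finsetSum _ fun j _ => i4 j).const_mul _
  refine ⟨(i3.sub i5).add (integrable_const _), ?_⟩
  refine (integral_add (i3.sub i5) (integrable_const _)).trans ?_
  rw [integral_sub' i3 i5, integral_const_mul,
    integral_finsetSum _ fun j _ => i4 j, integral_finsetSum _ fun j _ => i2 j]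
  simp only [integral_const_mul, h.integral_eq, integral_finsetSum _ fun k _ => i1 _ k,
    h.integral_mul, integral_const]
  simp [Matrix.trace, Finset.mul_sum, mul_comm, add_comm]

theorem expectedRisk_eq {X : Type*} (h : IsNoise P ε s) (hn : 0 < n) (x : Fin n → X)
    (fstar f : X → ℝ) :
    expectedRisk P x fstar ε f =
      1 / n * ((fun i => f (x i) - fstar (x i)) ⬝ᵥ (fun i => f (x i) - fstar (x i))) + s := by
  have hn' : (n : ℝ) ≠ 0 := by exact_mod_cast hn.ne'
  have e : ∀ ω, 1 / (n : ℝ) * ∑ i, (f (x i) - outputs x fstar ε ω i) ^ 2 =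
      1 / n * (((1 : Matrix (Fin n) (Fin n) ℝ) *ᵥ (fun i => ε i ω) -
        (fun i => f (x i) - fstar (x i))) ⬝ᵥ ((1 : Matrix (Fin n) (Fin n) ℝ) *ᵥ
          (fun i => ε i ω) - (fun i => f (x i) - fstar (x i)))) := by
    intro ω
    congr 1
    simp only [dotProduct, Matrix.one_mulVec, Pi.sub_apply, outputs]
    exact Finset.sum_congr rfl fun i _ => by ring
  rw [expectedRisk]
  simp only [e]
  rw [integral_const_mul, (h.biasVariance 1 _).2]
  simp
  field_simp

section RKHS

variable {X : Type*} {H : Type*} [NormedAddCommGroup H] [InnerProductSpace ℝ H]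
  [CompleteSpace H] [RKHS ℝ H X ℝ]

/-- The evaluation of the functions of the RKHS at the design points. -/
noncomputable def evalAt (H : Type*) [NormedAddCommGroup H] [InnerProductSpace ℝ H]
    [RKHS ℝ H X ℝ] (x : Fin n → X) : H →ₗ[ℝ] EuclideanSpace ℝ (Fin n) where
  toFun v := WithLp.toLp 2 fun i => v (x i)
  map_add' u v := by
    ext i
    simp
  map_smul' c v := by
    ext i
    simp

/-- The best approximation of a vector by the values of a function of the RKHS. -/
theorem exists_best_approximation (H : Type*) [NormedAddCommGroup H] [InnerProductSpace ℝ H]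
    [RKHS ℝ H X ℝ] (x : Fin n → X) (μ : Fin n → ℝ) :
    ∃ g : H, ∀ v : H, (fun i => v (x i)) ⬝ᵥ (μ - fun i => g (x i)) = 0 := by
  set W := LinearMap.range (evalAt H x)
  obtain ⟨g, hg⟩ : W.starProjection (WithLp.toLp 2 μ) ∈ W := Submodule.starProjection_apply_mem _ _
  refine ⟨g, fun v => ?_⟩
  have h := Submodule.sub_starProjection_mem_orthogonal (K := W) (WithLp.toLp 2 μ)
  rw [← hg] at h
  have h2 := (Submodule.mem_orthogonal W _).1 h (evalAt H x v) ⟨v, rfl⟩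
  simpa [evalAt, PiLp.inner_apply, dotProduct, mul_comm] using h2

/-- Pythagoras around the best approximation `g`, whose risk attains the infimum. The estimator need
only have values orthogonal to the residual, so membership in `H` is not required. -/
theorem excessRisk_eq (h : IsNoise P ε s) (hn : 0 < n) (x : Fin n → X) (fstar f : X → ℝ)
    {g : H} (hg : ∀ v : H, (fun i => v (x i)) ⬝ᵥ ((fun i => fstar (x i)) - fun i => g (x i)) = 0)
    (hf : (fun i => f (x i)) ⬝ᵥ ((fun i => fstar (x i)) - fun i => g (x i)) = 0) :
    excessRisk H P x fstar ε f =
      1 / n * (((fun i => f (x i)) - fun i => g (x i)) ⬝ᵥ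
        ((fun i => f (x i)) - fun i => g (x i))) := by
  have hn' : (0 : ℝ) < n := by exact_mod_cast hn
  set m : Fin n → ℝ := fun i => fstar (x i) with hm
  set g0 : Fin n → ℝ := fun i => g (x i) with hg0
  have hpyth : ∀ w : Fin n → ℝ, w ⬝ᵥ (m - g0) = 0 →
      (w - m) ⬝ᵥ (w - m) = (w - g0) ⬝ᵥ (w - g0) + (m - g0) ⬝ᵥ (m - g0) := by
    intro w hw
    have h0 := hg g
    have e : w - m = (w - g0) - (m - g0) := by abel
    have e2 : (w - g0) ⬝ᵥ (m - g0) = 0 := by rw [sub_dotProduct, hw, h0, sub_zero]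
    rw [e, sub_dotProduct, dotProduct_sub, dotProduct_sub _ (w - g0),
      dotProduct_comm (m - g0) (w - g0), e2]
    ring
  have hrisk : ∀ f : X → ℝ, (fun i => f (x i)) ⬝ᵥ (m - g0) = 0 →
      expectedRisk P x fstar ε f = 1 / n * (((fun i => f (x i)) - g0) ⬝ᵥ
        ((fun i => f (x i)) - g0) + (m - g0) ⬝ᵥ (m - g0)) + s := by
    intro f hf
    rw [expectedRisk_eq h hn, ← hpyth _ hf]
    rfl
  have hinf : ⨅ v : H, expectedRisk P x fstar ε v = 1 / n * ((m - g0) ⬝ᵥ (m - g0)) + s := by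
    have hle : ∀ v : H, 1 / n * ((m - g0) ⬝ᵥ (m - g0)) + s ≤ expectedRisk P x fstar ε v := by
      intro v
      rw [hrisk v (hg v)]
      have := dotProduct_self_nonneg' ((fun i => v (x i)) - g0)
      gcongr
      linarith
    refine le_antisymm ?_ (le_ciInf hle)
    refine (ciInf_le ⟨_, Set.forall_mem_range.2 hle⟩ g).trans (le_of_eq ?_)
    rw [hrisk g (hg g)]
    simp [← hg0]
  rw [excessRisk, hinf, hrisk f hf]
  ring

/-- The expected excess risk of a linear smoother with values in the RKHS. -/
theorem integral_excessRisk_eq (h : IsNoise P ε s) (hn : 0 < n) (x : Fin n → X)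
    (fstar : X → ℝ) {g : H}
    (hg : ∀ v : H, (fun i => v (x i)) ⬝ᵥ ((fun i => fstar (x i)) - fun i => g (x i)) = 0)
    {N : Matrix (Fin n) (Fin n) ℝ} (hNs : Nᵀ = N)
    (hN : N *ᵥ ((fun i => fstar (x i)) - fun i => g (x i)) = 0)
    {f : (Fin n → ℝ) → X → ℝ} (hf : ∀ y, (fun i => f y (x i)) = N *ᵥ y) :
    Integrable (fun ω => excessRisk H P x fstar ε (f (outputs x fstar ε ω))) P ∧
    ∫ ω, excessRisk H P x fstar ε (f (outputs x fstar ε ω)) ∂P =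
      1 / n * (((fun i => g (x i)) - N *ᵥ fun i => g (x i)) ⬝ᵥ
        ((fun i => g (x i)) - N *ᵥ fun i => g (x i)) + s * (N * N).trace) := by
  have e : ∀ ω, excessRisk H P x fstar ε (f (outputs x fstar ε ω)) =
      1 / n * ((N *ᵥ (fun i => ε i ω) - ((fun i => g (x i)) - N *ᵥ fun i => g (x i))) ⬝ᵥ
        (N *ᵥ (fun i => ε i ω) - ((fun i => g (x i)) - N *ᵥ fun i => g (x i)))) := by
    intro ω
    rw [excessRisk_eq h hn x fstar _ hg]
    · have h1 : (fun i => f (outputs x fstar ε ω) (x i)) - (fun i => g (x i)) =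
          N *ᵥ (fun i => ε i ω) - ((fun i => g (x i)) - N *ᵥ fun i => g (x i)) := by
        have h2 : outputs x fstar ε ω = (fun i => fstar (x i)) + fun i => ε i ω := rfl
        rw [Matrix.mulVec_sub, sub_eq_zero] at hN
        rw [hf, h2, Matrix.mulVec_add, hN]
        abel
      rw [h1]
    · rw [hf, ← dotProduct_mulVec_symm hNs, hN, dotProduct_zero]
  have hb := h.biasVariance N ((fun i => g (x i)) - N *ᵥ fun i => g (x i))
  simp only [e]
  refine ⟨hb.1.const_mul _, ?_⟩
  rw [integral_const_mul, hb.2, hNs]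

end RKHS

end Risk

/-! ### Values of the two estimators at the design points -/

section Estimators

variable {X : Type*} {H : Type*} [NormedAddCommGroup H] [InnerProductSpace ℝ H]
  [CompleteSpace H] [RKHS ℝ H X ℝ] {K : X → X → ℝ}

theorem IsReproducingKernel.eq_inner (hK : IsReproducingKernel H K) (u v : X) :
    K u v = inner ℝ (RKHS.kerFun H v (1 : ℝ)) (RKHS.kerFun H u (1 : ℝ)) := by
  rw [← hK, ← RKHS.kernel_inner]
  simp

theorem IsReproducingKernel.symm (hK : IsReproducingKernel H K) (u v : X) : K u v = K v u := by
  rw [hK.eq_inner, hK.eq_inner, real_inner_comm]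

variable {n : ℕ}

theorem IsReproducingKernel.transpose_kernelMatrix (hK : IsReproducingKernel H K)
    (x : Fin n → X) : (kernelMatrix K x)ᵀ = kernelMatrix K x := by
  ext i j
  exact hK.symm _ _

theorem IsReproducingKernel.kernelMatrix_nonneg (hK : IsReproducingKernel H K) (x : Fin n → X)
    (v : Fin n → ℝ) : 0 ≤ v ⬝ᵥ (kernelMatrix K x *ᵥ v) := by
  have e : v ⬝ᵥ (kernelMatrix K x *ᵥ v) =
      inner ℝ (∑ i, v i • RKHS.kerFun H (x i) (1 : ℝ)) (∑ i, v i • RKHS.kerFun H (x i) (1 : ℝ)) := by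
    simp only [sum_inner, inner_sum, real_inner_smul_left, real_inner_smul_right, dotProduct,
      Matrix.mulVec, kernelMatrix, Matrix.of_apply, Finset.mul_sum]
    refine Finset.sum_congr rfl fun i _ => Finset.sum_congr rfl fun j _ => ?_
    rw [hK.eq_inner]
    ring
  rw [e]
  exact real_inner_self_nonneg

/-- The kernel sections at the design points belong to `H`, and their values there are the rows of
the kernel matrix. -/
theorem IsReproducingKernel.kernelMatrix_mulVec_eq_zero (hK : IsReproducingKernel H K)
    (x : Fin n → X) {r : Fin n → ℝ} (hr : ∀ v : H, (fun i => v (x i)) ⬝ᵥ r = 0) :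
    kernelMatrix K x *ᵥ r = 0 := by
  ext i
  rw [Pi.zero_apply, ← hr (RKHS.kerFun H (x i) (1 : ℝ))]
  simp only [Matrix.mulVec, dotProduct, kernelMatrix, Matrix.of_apply, RKHS.kerFun_apply]
  exact Finset.sum_congr rfl fun j _ => by rw [hK.symm, hK]

theorem krls_apply (K : X → X → ℝ) (x : Fin n → X) (lam : ℝ) (y : Fin n → ℝ) :
    (fun i => krls K x lam y (x i)) =
      (kernelMatrix K x * (kernelMatrix K x + (lam * n) • 1)⁻¹) *ᵥ y := by
  rw [← Matrix.mulVec_mulVec]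
  ext i
  simp only [krls, Matrix.mulVec, dotProduct, kernelMatrix, Matrix.of_apply]
  exact Finset.sum_congr rfl fun j _ => mul_comm _ _

/-- The values of the iterates of gradient descent at the design points. -/
theorem crossKernelMatrix_mulVec_nytroBeta {k : ℕ} (K : X → X → ℝ) (x : Fin n → X)
    (M : Finset (Fin n)) (R : Matrix M (Fin k) ℝ) (γ : ℝ) (y : Fin n → ℝ) (t : ℕ) :
    (crossKernelMatrix K x M * R) *ᵥ nytroBeta K x M R γ y t =
      (1 - (1 - (γ / n) • ((crossKernelMatrix K x M * R) * (crossKernelMatrix K x M * R)ᵀ)) ^ t)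
        *ᵥ y := by
  set A := crossKernelMatrix K x M * R with hA
  set C := (γ / n) • (A * Aᵀ) with hC
  induction t with
  | zero => simp [nytroBeta]
  | succ t ih =>
    have h1 : nytroBeta K x M R γ y (t + 1) = nytroBeta K x M R γ y t -
        (γ / n) • (Aᵀ *ᵥ (A *ᵥ nytroBeta K x M R γ y t - y)) := by
      rw [nytroBeta, hA, Matrix.transpose_mul]
      simp only [← Matrix.mulVec_mulVec]
    have h2 : A *ᵥ nytroBeta K x M R γ y (t + 1) = A *ᵥ nytroBeta K x M R γ y t -
        C *ᵥ (A *ᵥ nytroBeta K x M R γ y t - y) := by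
      rw [h1, Matrix.mulVec_sub, Matrix.mulVec_smul, Matrix.mulVec_mulVec, hC, Matrix.smul_mulVec]
    have h3 : (1 - (1 - C) ^ t) *ᵥ y - y = -((1 - C) ^ t *ᵥ y) := by
      rw [Matrix.sub_mulVec, Matrix.one_mulVec]
      abel
    rw [h2, ih, h3, Matrix.mulVec_neg, sub_neg_eq_add, Matrix.mulVec_mulVec, ← Matrix.add_mulVec,
      pow_succ']
    congr 1
    rw [Matrix.sub_mul, Matrix.one_mul]
    abel

theorem IsReproducingKernel.nytro_apply (hK : IsReproducingKernel H K) {k : ℕ} (x : Fin n → X)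
    (M : Finset (Fin n)) (R : Matrix M (Fin k) ℝ) (γ : ℝ) (y : Fin n → ℝ) (t : ℕ) :
    (fun i => nytro K x M R γ t y (x i)) =
      (1 - (1 - (γ / n) • ((crossKernelMatrix K x M * R) * (crossKernelMatrix K x M * R)ᵀ)) ^ t)
        *ᵥ y := by
  rw [← crossKernelMatrix_mulVec_nytroBeta, ← Matrix.mulVec_mulVec]
  ext i
  simp only [nytro, Matrix.mulVec, dotProduct, crossKernelMatrix, Matrix.of_apply]
  exact Finset.sum_congr rfl fun j _ => by rw [hK.symm, mul_comm]

theorem one_sub_pow_mulVec_of_mulVec_eq_zero {C : Matrix (Fin n) (Fin n) ℝ} {r : Fin n → ℝ}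
    (h : C *ᵥ r = 0) (t : ℕ) : (1 - (1 - C) ^ t) *ᵥ r = 0 := by
  have : (1 - C) ^ t *ᵥ r = r := by
    induction t with
    | zero => simp
    | succ t ih =>
      rw [pow_succ, ← Matrix.mulVec_mulVec, Matrix.sub_mulVec, h, Matrix.one_mulVec, sub_zero, ih]
  rw [Matrix.sub_mulVec, this, Matrix.one_mulVec, sub_self]

end Estimators

end Nytro

/-! ### Assembly: risk comparison for each `M`, then averaging over `M` -/

theorem mainTheorem6
    -- the input space, the kernel `K` and the RKHS `H` it induces
    {X : Type*} {H : Type*} [NormedAddCommGroup H] [InnerProductSpace ℝ H] [CompleteSpace H]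
    [RKHS ℝ H X ℝ] (K : X → X → ℝ) (hK : Nytro.IsReproducingKernel H K)
    -- the fixed design, the target function and the i.i.d. centred noise of variance `σ²`
    {n : ℕ} (x : Fin n → X) (hKn : Nytro.kernelMatrix K x ≠ 0) (fstar : X → ℝ)
    {Ω : Type*} [MeasurableSpace Ω] (P : Measure Ω) [IsProbabilityMeasure P]
    (ρ : Measure ℝ) [IsProbabilityMeasure ρ] (σ : ℝ)
    (hρ : MemLp id 2 ρ) (hmean : ∫ e, e ∂ρ = 0) (hvar : variance id ρ = σ ^ 2)
    (ε : Fin n → Ω → ℝ) (hindep : iIndepFun ε P) (hlaw : ∀ i, HasLaw (ε i) ρ P)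
    -- the parameters
    (t : ℕ) (ht : 2 ≤ t) (γ : ℝ) (hγ : γ = 1 / Nytro.opNorm (Nytro.kernelMatrix K x))
    (δ : ℝ) (hδ0 : 0 < δ) (hδ1 : δ < 1) (m : ℕ) (hmn : m ≤ n)
    (hm : (32 * (Nytro.dTilde (Nytro.kernelMatrix K x) (1 / (γ * t)) / δ) + 2) *
        Real.log (n * Nytro.opNorm (Nytro.kernelMatrix K x) * γ * t / δ) ≤ (m : ℝ))
    -- for each subset `M` of size `m`, any factor `R` of the pseudoinverse of `K_mm`, with as many
    -- columns as the rank of `K_mm`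
    (R : (M : Finset (Fin n)) → Matrix M (Fin (Nytro.subKernelMatrix K x M).rank) ℝ)
    (hR : ∀ M : Finset (Fin n), M.card = m →
      Nytro.IsPseudoinverse (Nytro.subKernelMatrix K x M) (R M * (R M)ᵀ)) :
    -- the expectations below are those of integrable functions
    (∀ M : Finset (Fin n), M.card = m →
      Integrable (fun ω => Nytro.excessRisk H P x fstar ε
        (Nytro.nytro K x M (R M) γ t (Nytro.outputs x fstar ε ω))) P) ∧
    Integrable (fun ω => Nytro.excessRisk H P x fstar ε
        (Nytro.krls K x (1 / (γ * t)) (Nytro.outputs x fstar ε ω))) P ∧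
    -- the average over all subsets of size `m` is the expectation over a uniformly random one
    Finset.expect (Finset.powersetCard m (Finset.univ : Finset (Fin n))) (fun M =>
        ∫ ω, Nytro.excessRisk H P x fstar ε
          (Nytro.nytro K x M (R M) γ t (Nytro.outputs x fstar ε ω)) ∂P) ≤
      4 * (1 + 1 / ((t : ℝ) - 1)) ^ 2 * (1 + 4 * δ) *
        ∫ ω, Nytro.excessRisk H P x fstar ε
          (Nytro.krls K x (1 / (γ * t)) (Nytro.outputs x fstar ε ω)) ∂P ∧
    4 * (1 + 1 / ((t : ℝ) - 1)) ^ 2 * (1 + 4 * δ) ≤ 80 := by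
  classical
  have hKs := hK.transpose_kernelMatrix x
  have hKp := hK.kernelMatrix_nonneg x
  have hn : 0 < n := by
    rcases Nat.eq_zero_or_pos n with rfl | h
    · exact absurd (Subsingleton.elim _ _) hKn
    · exact h
  have : NeZero n := ⟨hn.ne'⟩
  have hn' : (0 : ℝ) < n := by exact_mod_cast hn
  have ht' : (2 : ℝ) ≤ t := by exact_mod_cast ht
  have ht0 : (0 : ℝ) < t := by linarith
  have hop := Nytro.opNorm_pos hKn
  have hγ0 : 0 < γ := by rw [hγ]; positivity
  have hκγ : Nytro.opNorm (Nytro.kernelMatrix K x) * γ = 1 := by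
    rw [hγ, mul_one_div_cancel hop.ne']
  have hnoise := Nytro.isNoise_of_iIndepFun hρ hmean hvar hindep hlaw
  obtain ⟨g, hg⟩ := Nytro.exists_best_approximation H x fun i => fstar (x i)
  have hridge := Nytro.isRidge_smoother hKs hKp hn hγ0 ht0
  have hkrls : ∀ y, (fun i => Nytro.krls K x (1 / (γ * t)) y (x i)) = _ :=
    Nytro.krls_apply K x (1 / (γ * t))
  have hdd : ∀ i, (Nytro.kernelMatrix K x * (Nytro.kernelMatrix K x +
      (1 / (γ * t) * n) • (1 : Matrix (Fin n) (Fin n) ℝ))⁻¹) i i ≤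
        Nytro.dTilde (Nytro.kernelMatrix K x) (1 / (γ * t)) / n := fun i => by
    rw [Nytro.dTilde, mul_div_cancel_left₀ _ hn'.ne']
    exact le_ciSup (f := fun i => (Nytro.kernelMatrix K x * (Nytro.kernelMatrix K x +
      (1 / (γ * t) * n) • (1 : Matrix (Fin n) (Fin n) ℝ))⁻¹) i i) (Set.finite_range _).bddAbove i
  set r : Fin n → ℝ := (fun i => fstar (x i)) - fun i => g (x i) with hr
  have hKr := hK.kernelMatrix_mulVec_eq_zero x hg
  set A := Nytro.kernelMatrix K x with hA
  set S := A * (A + (1 / (γ * t) * n) • (1 : Matrix (Fin n) (Fin n) ℝ))⁻¹ with hSdef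
  set d := Nytro.dTilde A (1 / (γ * t)) with hd
  set L := Real.log (n * t / δ) with hL
  set μ : Fin n → ℝ := fun i => g (x i) with hμ
  set B := (γ / n) • A with hB
  -- Applying `S B + (1/t) S = B` to `r`, with `B r = 0`, leaves `(1/t) S r = 0`.
  have hSr : S *ᵥ r = 0 := by
    have h1 := congrArg (fun Z => Z *ᵥ r) hridge.mul_eq
    simp only [Matrix.add_mulVec, ← Matrix.mulVec_mulVec, Matrix.smul_mulVec, hB, hKr,
      smul_zero, Matrix.mulVec_zero, zero_add] at h1
    exact (smul_eq_zero.1 h1).resolve_left hridge.pos.ne'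
  have hkr := Nytro.integral_excessRisk_eq hnoise hn x fstar hg hridge.symm hSr hkrls
  have hBle : ∀ v, v ⬝ᵥ (B *ᵥ v) ≤ 1 / n * (v ⬝ᵥ v) := fun v => by
    rw [hB, Matrix.smul_mulVec, dotProduct_smul, smul_eq_mul]
    have h1 := mul_le_mul_of_nonneg_left (Nytro.dotProduct_mulVec_le_opNorm A v)
      (div_nonneg hγ0.le hn'.le)
    refine h1.trans (le_of_eq ?_)
    rw [← mul_assoc, div_mul_eq_mul_div, mul_comm γ, hκγ]
  obtain ⟨F, hF⟩ := hridge.exists_factor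
  set C : Finset (Fin n) → Matrix (Fin n) (Fin n) ℝ := fun M =>
    (γ / n) • ((Nytro.crossKernelMatrix K x M * R M) * (Nytro.crossKernelMatrix K x M * R M)ᵀ)
    with hC
  set p := ⌈2 * L⌉₊ with hp
  set b2 := (μ - S *ᵥ μ) ⬝ᵥ (μ - S *ᵥ μ) with hb2
  set V := (S * S).trace with hV
  have hM : ∀ M : Finset (Fin n), M.card = m →
      Integrable (fun ω => Nytro.excessRisk H P x fstar ε
        (Nytro.nytro K x M (R M) γ t (Nytro.outputs x fstar ε ω))) P ∧
      ∫ ω, Nytro.excessRisk H P x fstar ε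
        (Nytro.nytro K x M (R M) γ t (Nytro.outputs x fstar ε ω)) ∂P ≤
        1 / n * ((4 + (1 + 1 / (n : ℝ) * t) ^ 2 * 2 ^ p *
          (Nytro.residualGram F M ^ p).trace) * b2 + 4 * (σ ^ 2 * V)) := by
    intro M hMm
    have hres := Nytro.nystrom_residual hKs hKp (hR M hMm)
    have hCs : (C M)ᵀ = C M := by
      simp only [hC, Matrix.transpose_smul, Matrix.transpose_mul, Matrix.transpose_transpose]
    have hCquad : ∀ v, v ⬝ᵥ (C M *ᵥ v) = γ / n *
        (((Nytro.crossKernelMatrix K x M * R M)ᵀ *ᵥ v) ⬝ᵥ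
          ((Nytro.crossKernelMatrix K x M * R M)ᵀ *ᵥ v)) := fun v => by
      simp only [hC]
      rw [Matrix.smul_mulVec, dotProduct_smul, Nytro.mul_transpose_dotProduct_nonneg, smul_eq_mul]
    have hCp : ∀ v, 0 ≤ v ⬝ᵥ (C M *ᵥ v) := fun v => by
      rw [hCquad]
      exact mul_nonneg (by positivity) (Nytro.dotProduct_self_nonneg' _)
    have hBC : B - C M = (γ / n) • (A - (A.submatrix id ((↑) : M → Fin n) * R M) *
        (A.submatrix id ((↑) : M → Fin n) * R M)ᵀ) := by
      rw [smul_sub]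
      rfl
    have hSchur : ∀ v w : Fin n → ℝ, (∀ i, i ∉ M → w i = 0) →
        v ⬝ᵥ ((B - C M) *ᵥ v) ≤ (v - w) ⬝ᵥ (B *ᵥ (v - w)) := fun v w hw => by
      rw [hBC, hB, Matrix.smul_mulVec, Matrix.smul_mulVec, dotProduct_smul, dotProduct_smul]
      exact mul_le_mul_of_nonneg_left (hres v w hw).2 (by positivity)
    have hCB : ∀ v, v ⬝ᵥ (C M *ᵥ v) ≤ v ⬝ᵥ (B *ᵥ v) := fun v => by
      have h1 : 0 ≤ v ⬝ᵥ ((B - C M) *ᵥ v) := by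
        rw [hBC, Matrix.smul_mulVec, dotProduct_smul]
        exact mul_nonneg (by positivity) (hres v 0 fun _ _ => rfl).1
      rw [Matrix.sub_mulVec, dotProduct_sub] at h1
      linarith
    have hb1 : 1 / (n : ℝ) ≤ 1 := (div_le_one hn').2 (by exact_mod_cast hn)
    have hC1 : ∀ v, v ⬝ᵥ (C M *ᵥ v) ≤ v ⬝ᵥ v := fun v => ((hCB v).trans (hBle v)).trans
      (mul_le_of_le_one_left (Nytro.dotProduct_self_nonneg' v) hb1)
    -- `0 ≤ C ≤ B` as quadratic forms, so the kernel of `B` is contained in that of `C`.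
    have hCr : C M *ᵥ r = 0 := by
      have h1 := hCB r
      rw [hCquad, hB, Matrix.smul_mulVec, hKr, smul_zero, dotProduct_zero] at h1
      have h2 := Nytro.dotProduct_self_nonneg' ((Nytro.crossKernelMatrix K x M * R M)ᵀ *ᵥ r)
      have h3 : 0 < γ / n := by positivity
      have h4 : (Nytro.crossKernelMatrix K x M * R M)ᵀ *ᵥ r = 0 :=
        dotProduct_self_eq_zero.1 (by nlinarith)
      simp only [hC]
      rw [Matrix.smul_mulVec, ← Matrix.mulVec_mulVec, h4, Matrix.mulVec_zero, smul_zero]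
    have hNs : (1 - (1 - C M) ^ t)ᵀ = 1 - (1 - C M) ^ t := by
      rw [Matrix.transpose_sub, Matrix.transpose_one, Nytro.one_sub_pow_transpose hCs]
    have hint := Nytro.integral_excessRisk_eq hnoise hn x fstar hg hNs
      (Nytro.one_sub_pow_mulVec_of_mulVec_eq_zero hCr t)
      (f := fun y => Nytro.nytro K x M (R M) γ t y)
      fun y => hK.nytro_apply x M (R M) γ y t
    refine ⟨hint.1, hint.2.le.trans ?_⟩
    have hbias := Nytro.nystrom_bias_le (by omega) hridge hCs hCp hCB (by positivity) hb1 hBle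
      hSchur hF p μ
    have hvar := Nytro.trace_gradientDescent_sq_le (by omega) hridge hCs hCp hCB hC1
    have he : μ - (1 - (1 - C M) ^ t) *ᵥ μ = (1 - C M) ^ t *ᵥ μ := by
      rw [Matrix.sub_mulVec, Matrix.one_mulVec, sub_sub_cancel]
    rw [← hμ, he]
    refine mul_le_mul_of_nonneg_left ?_ (by positivity)
    have := mul_le_mul_of_nonneg_left hvar (sq_nonneg σ)
    linarith
  have hFnorm : ∀ v, (F *ᵥ v) ⬝ᵥ (F *ᵥ v) ≤ v ⬝ᵥ v := fun v => by
    refine le_trans (le_of_eq ?_) (hridge.dotProduct_le v)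
    rw [← hF, ← Matrix.mulVec_mulVec, Matrix.dotProduct_mulVec v, Matrix.vecMul_transpose]
  have hFcol : ∀ i, F.col i ⬝ᵥ F.col i ≤ d / Fintype.card (Fin n) := fun i => by
    rw [Fintype.card_fin]
    refine le_trans (le_of_eq ?_) (hdd i)
    rw [← hF]
    rfl
  have hd0 : 0 ≤ d := by
    have h1 := (Nytro.dotProduct_self_nonneg' (F.col 0)).trans (hFcol 0)
    rw [Fintype.card_fin] at h1
    by_contra h
    exact absurd h1 (not_le.2 (div_neg_of_neg_of_pos (not_le.1 h) hn'))
  have hL0 : 0 < L := by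
    refine Real.log_pos ?_
    rw [lt_div_iff₀ hδ0]
    have : (1 : ℝ) ≤ n := by exact_mod_cast hn
    nlinarith
  -- Since `‖K_n‖ γ = 1`, the logarithm in the hypothesis is `L`. Both the summand `2` and the
  -- division of `d` by `δ` are slack here: `δ` enters through `L`.
  have hmL : 32 * L * d ≤ m := by
    have e : n * Nytro.opNorm A * γ * t / δ = n * t / δ := by
      rw [mul_assoc (n : ℝ), hκγ, mul_one]
    rw [e, ← hL] at hm
    refine le_trans ?_ hm
    have : d ≤ d / δ := by
      rw [le_div_iff₀ hδ0]
      nlinarith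
    nlinarith
  have hp0 : p ≠ 0 := (Nat.ceil_pos.2 (by positivity)).ne'
  have hmoment := Nytro.expect_trace_residualGram_pow_le_exp hFnorm (c := 1 / 6) (by norm_num)
    hFcol hp0 (m := m) (by rwa [Fintype.card_fin]) hmL
  rw [Fintype.card_fin] at hmoment
  have hnum := Nytro.failure_bound hn ht hδ0 hδ1
  rw [← hL, ← hp] at hnum
  have hb20 : 0 ≤ b2 := Nytro.dotProduct_self_nonneg' _
  have hV0 : 0 ≤ V := by
    have h1 : V = (Sᵀ * S).trace := by rw [hridge.symm]
    rw [h1]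
    exact Finset.sum_nonneg fun i _ => Nytro.dotProduct_self_nonneg' (S.col i)
  have hfrac : (t : ℝ) - 1 ≥ 1 := by linarith
  have hq0 : 0 ≤ 1 / ((t : ℝ) - 1) := by positivity
  have hq1 : 1 / ((t : ℝ) - 1) ≤ 1 := (div_le_one (by linarith)).2 hfrac
  refine ⟨fun M h => (hM M h).1, hkr.1, ?_, ?_⟩
  · have hle := Finset.expect_le_expect
      (s := Finset.powersetCard m (Finset.univ : Finset (Fin n)))
      fun M h => (hM M (Finset.mem_powersetCard.1 h).2).2
    refine hle.trans ?_
    have hne : (Finset.powersetCard m (Finset.univ : Finset (Fin n))).Nonempty := by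
      rw [Finset.powersetCard_nonempty]
      simpa using hmn
    rw [hkr.2, ← Finset.mul_expect, Finset.expect_add_distrib, Finset.expect_const hne,
      ← Finset.expect_mul, Finset.expect_add_distrib, Finset.expect_const hne, ← Finset.mul_expect]
    set E := Finset.expect (Finset.powersetCard m (Finset.univ : Finset (Fin n)))
      fun M => (Nytro.residualGram F M ^ p).trace
    have h1 : (1 + 1 / (n : ℝ) * t) ^ 2 * 2 ^ p * E ≤ 16 * δ :=
      (mul_le_mul_of_nonneg_left hmoment (by positivity)).trans hnum
    have h2 : (4 + (1 + 1 / (n : ℝ) * t) ^ 2 * 2 ^ p * E) * b2 + 4 * (σ ^ 2 * V) ≤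
        4 * (1 + 4 * δ) * (b2 + σ ^ 2 * V) := by
      have h3 := mul_le_mul_of_nonneg_right h1 hb20
      have h4 : 0 ≤ δ * (σ ^ 2 * V) := by positivity
      linarith
    -- The comparison already holds with `4 (1 + 4 δ)`; the factor depending on `t` is only used as
    -- a number at least `1`.
    have h5 : 1 ≤ (1 + 1 / ((t : ℝ) - 1)) ^ 2 := one_le_pow₀ (by linarith)
    have h6 : 0 ≤ 1 / (n : ℝ) * (4 * (1 + 4 * δ) * (b2 + σ ^ 2 * V)) := by positivity
    calc 1 / (n : ℝ) * ((4 + (1 + 1 / (n : ℝ) * t) ^ 2 * 2 ^ p * E) * b2 + 4 * (σ ^ 2 * V))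
        ≤ 1 / (n : ℝ) * (4 * (1 + 4 * δ) * (b2 + σ ^ 2 * V)) :=
          mul_le_mul_of_nonneg_left h2 (by positivity)
      _ ≤ (1 + 1 / ((t : ℝ) - 1)) ^ 2 * (1 / (n : ℝ) * (4 * (1 + 4 * δ) * (b2 + σ ^ 2 * V))) :=
          le_mul_of_one_le_left h6 h5
      _ = _ := by ring
  · have h1 : (1 + 1 / ((t : ℝ) - 1)) ^ 2 ≤ 2 ^ 2 := pow_le_pow_left₀ (by linarith) (by linarith) 2
    nlinarith
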